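/- Let $\Gamma$ be a countable group, let $(B,d_B)$ be a compact metric space with its Borel $\sigma$-algebra, let $\nu$ be a Borel probability measure on $B$, and let $\Gamma\curvearrowright(B,\nu)$ be a nonsingular action by Borel maps. Write $(\nu\circ g)(E)=\nu(gE)$. Let $R:\Gamma\times B\to\mathbb R$ be Borel with $R(g_2g_1,b)=R(g_2,g_1b)+R(g_1,b)$ for all $g_1,g_2\in\Gamma$, $b\in B$, and with $R(g,b)=\log\frac{d\nu\circ g}{d\nu}(b)$ for every $g$ and $\nu$-almost every $b$. *Definitions.* The action is **ergodic** if every invariant measurable set is $\nu$-null or $\nu$-conull. It is **weakly mixing** if for every ergodic probability-measure-preserving (pmp) action of $\Gamma$ on a standard probability space $(X,\mu)$ the diagonal action $\Gamma\curvearrowright(B\times X,\nu\times\mu)$ is ergodic. The **ratio set** $RS(\Gamma\curvearrowright(B,\nu))\subset[0,\infty]$ is defined as follows. A real $r\ge 0$ belongs to it iff for every measurable $A\subset B$ with $\nu(A)>0$ and every $\epsilon>0$ there are a measurable $A'\subset A$ with $\nu(A')>0$ and $g\in\Gamma\setminus\{e\}$ with $gA'\subset A$ and $|\frac{d\nu\circ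 g}{d\nu}(b)-r|<\epsilon$ for all $b\in A'$. The point $\infty$ belongs to it iff for every such $A$ and every $n>0$ there are such $A'$ and $g$ with $gA'\subset A$ and $\frac{d\nu\circ g}{d\nu}(b)>n$ for all $b\in A'$. The **stable ratio set** is the intersection of $RS(\Gamma\curvearrowright(B\times X,\nu\times\mu))$ over all pmp actions of $\Gamma$ on standard probability spaces $(X,\mu)$. An ergodic action is of **type $III_0$** if its ratio set is $\{0,1,\infty\}$; a weakly mixing action is of **stable type $III_0$** if its stable ratio set is $\{0,1,\infty\}$. An **admissible family** is a sequence of nonnegative real-valued Borel functions $\Upsilon_n$ on $\Gamma\times B\times B$ such that, with $S_n=\{(g,b,b'):\Upsilon_n(g,b,b')>0\}$: 1. $\sum_{g\in\Gamma}\int\Upsilon_n(g,b,b')\,d\nu(b')=1$ for all $n$ and $b$. 2. There is $\beta:\mathbb N\to\mathbb R$ with $\beta(n)\to0$ such that $d_B(b,b')\le\beta(n)$ and $d_B(g^{-1}b,g^{-1}b')\le\beta(n)$ for all $n$ and all $(g,b,b')\in S_n$. 3. There is $C>0$ such that for all $n$, $|R(g^{-1},b)|+|R(g^{-1},b')|\le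 C$ for almost every $(g,b,b')\in S_n$ (with respect to the product of counting measure on $\Gamma$ and $\nu\times\nu$). 4. There is $C>0$ such that for all $n$, $$\int\sum_{g}\Upsilon_n(g,b,b')\,d\nu(b)\le C\ \text{ for a.e. } b',$$ $$\int\sum_{g}\Upsilon_n(g,b,gb')\tfrac{d\nu\circ g}{d\nu}(b')\,d\nu(b)\le C\ \text{ for a.e. } b',$$ $$\int\sum_{g}\Upsilon_n(g,gb,b')\tfrac{d\nu\circ g}{d\nu}(b)\,d\nu(b')\le C\ \text{ for a.e. } b.$$ *Statement.* Let $\{\Upsilon_n\}$ be an admissible family for $\Gamma\curvearrowright(B,\nu)$, let $\zeta_n$ be the probability measure on $\mathbb R$ given by $$\zeta_n(E)=\sum_{g\in\Gamma}\iint 1_E\big(R(g^{-1},b')-R(g^{-1},b)\big)\,\Upsilon_n(g,b,b')\,d\nu(b')\,d\nu(b),$$ and let $\zeta_\infty$ be any weak* limit point of $\{\zeta_n\}$ (a probability measure on $\mathbb R$). Suppose that some $T\neq0$ lies in the support of $\zeta_\infty$. If $\Gamma\curvearrowright(B,\nu)$ is ergodic, then it is not of type $III_0$. If $\Gamma\curvearrowright(B,\nu)$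 is weakly mixing, then it is not of stable type $III_0$. -/

import Mathlib

open MeasureTheory Filter Topology
open scoped ENNReal NNReal

noncomputable section

namespace NonsingularAction

/-- The action of `Γ` on `(B, ν)` is nonsingular: every group element acts by a measurable map
that sends `ν` to an absolutely continuous measure (hence, using inverses, to an equivalent
one). -/
def IsNonsingular (Γ : Type*) [Group Γ] {B : Type*} [MeasurableSpace B] [MulAction Γ B]
    (ν : Measure B) : Prop :=
  ∀ g : Γ, Measure.QuasiMeasurePreserving (fun b : B => g • b) ν ν

/-- The action of `Γ` on `(X, μ)` is measure preserving. -/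
def IsMeasurePreserving (Γ : Type*) [Group Γ] {X : Type*} [MeasurableSpace X] [MulAction Γ X]
    (μ : Measure X) : Prop :=
  ∀ g : Γ, MeasurePreserving (fun x : X => g • x) μ μ

/-- The action of `Γ` on `(B, ν)` is ergodic: every invariant measurable set is null or conull. -/
def IsErgodic (Γ : Type*) [Group Γ] {B : Type*} [MeasurableSpace B] [MulAction Γ B]
    (ν : Measure B) : Prop :=
  ∀ s : Set B, MeasurableSet s → (∀ g : Γ, (fun b : B => g • b) ⁻¹' s = s) →
    ν s = 0 ∨ ν sᶜ = 0

/-- The Radon–Nikodym derivative `d(ν ∘ g)/dν`, where `(ν ∘ g)(E) = ν (g E)`; thus `ν ∘ g` is the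
push-forward of `ν` under `g⁻¹`. -/
def rnDerivAction {Γ : Type*} [Group Γ] {B : Type*} [MeasurableSpace B] [MulAction Γ B]
    (ν : Measure B) (g : Γ) : B → ℝ≥0∞ :=
  (ν.map (fun b : B => g⁻¹ • b)).rnDeriv ν

/-- The ratio set of the action of `Γ` on `(B, ν)`, a subset of `[0, ∞]`. -/
def ratioSet (Γ : Type*) [Group Γ] {B : Type*} [MeasurableSpace B] [MulAction Γ B]
    (ν : Measure B) : Set ℝ≥0∞ :=
  {r | ∀ A : Set B, MeasurableSet A → 0 < ν A →
    (r ≠ ∞ → ∀ ε : ℝ, 0 < ε → ∃ A' ⊆ A, MeasurableSet A' ∧ 0 < ν A' ∧ ∃ g : Γ, g ≠ 1 ∧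
      (∀ b ∈ A', g • b ∈ A) ∧ ∀ b ∈ A', |(rnDerivAction ν g b).toReal - r.toReal| < ε) ∧
    (r = ∞ → ∀ n : ℕ, ∃ A' ⊆ A, MeasurableSet A' ∧ 0 < ν A' ∧ ∃ g : Γ, g ≠ 1 ∧
      (∀ b ∈ A', g • b ∈ A) ∧ ∀ b ∈ A', (n : ℝ≥0∞) < rnDerivAction ν g b)}

/-- The stable ratio set: the intersection of the ratio sets of the diagonal actions on
`(B × X, ν × μ)`, over all probability-measure-preserving actions of `Γ` on standard probability
spaces `(X, μ)`. (Every standard Borel space is isomorphic to one in `Type`.) -/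
def stableRatioSet (Γ : Type*) [Group Γ] {B : Type*} [MeasurableSpace B] [MulAction Γ B]
    (ν : Measure B) : Set ℝ≥0∞ :=
  {r | ∀ (X : Type) [MeasurableSpace X] [StandardBorelSpace X] [MulAction Γ X]
    (μ : Measure X) [IsProbabilityMeasure μ], IsMeasurePreserving Γ μ →
      r ∈ ratioSet Γ (ν.prod μ)}

/-- The action on `(B, ν)` is weakly mixing: its product with any ergodic
probability-measure-preserving action on a standard probability space is ergodic. -/
def IsWeaklyMixing (Γ : Type*) [Group Γ] {B : Type*} [MeasurableSpace B] [MulAction Γ B]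
    (ν : Measure B) : Prop :=
  ∀ (X : Type) [MeasurableSpace X] [StandardBorelSpace X] [MulAction Γ X]
    (μ : Measure X) [IsProbabilityMeasure μ], IsMeasurePreserving Γ μ → IsErgodic Γ μ →
      IsErgodic Γ (ν.prod μ)

/-- Type `III₀`: the action is ergodic (the type is undefined otherwise) with ratio set
`{0, 1, ∞}`. -/
def IsTypeIIIZero (Γ : Type*) [Group Γ] {B : Type*} [MeasurableSpace B] [MulAction Γ B]
    (ν : Measure B) : Prop :=
  IsErgodic Γ ν ∧ ratioSet Γ ν = {0, 1, ∞}

/-- Stable type `III₀`: the action is weakly mixing (the stable type is undefined otherwise) with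
stable ratio set `{0, 1, ∞}`. -/
def IsStableTypeIIIZero (Γ : Type*) [Group Γ] {B : Type*} [MeasurableSpace B] [MulAction Γ B]
    (ν : Measure B) : Prop :=
  IsWeaklyMixing Γ ν ∧ stableRatioSet Γ ν = {0, 1, ∞}

/-- `R` is a Borel additive cocycle, satisfying the cocycle identity everywhere and agreeing almost
everywhere with the logarithm of the Radon–Nikodym derivative. -/
structure IsLogRNCocycle {Γ : Type*} [Group Γ] {B : Type*} [MeasurableSpace B] [MulAction Γ B]
    (ν : Measure B) (R : Γ → B → ℝ) : Prop where
  measurable : ∀ g, Measurable (R g)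
  cocycle : ∀ g₂ g₁ b, R (g₂ * g₁) b = R g₂ (g₁ • b) + R g₁ b
  ae_eq : ∀ g, ∀ᵐ b ∂ν, R g b = Real.log (rnDerivAction ν g b).toReal

/-- Admissible families of kernels `Υ n : Γ × B × B → [0, ∞)`. As `Γ` is countable and discrete,
Borel measurability on `Γ × B × B`, and "almost everywhere" for the product of counting measure
with `ν × ν`, are expressed for each `g` separately. -/
structure IsAdmissibleFamily {Γ : Type*} [Group Γ] {B : Type*} [MetricSpace B]
    [MeasurableSpace B] [MulAction Γ B] (ν : Measure B) (R : Γ → B → ℝ)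
    (Υ : ℕ → Γ → B → B → ℝ≥0) : Prop where
  measurable : ∀ n g, Measurable (fun p : B × B => Υ n g p.1 p.2)
  sum_eq_one : ∀ n b, ∑' g, ∫⁻ b', (Υ n g b b' : ℝ≥0∞) ∂ν = 1
  dist_le : ∃ β : ℕ → ℝ, Tendsto β atTop (𝓝 0) ∧ ∀ n g b b', 0 < Υ n g b b' →
    dist b b' ≤ β n ∧ dist (g⁻¹ • b) (g⁻¹ • b') ≤ β n
  cocycle_bound : ∃ C : ℝ, 0 < C ∧ ∀ n g, ∀ᵐ p ∂(ν.prod ν), 0 < Υ n g p.1 p.2 →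
    |R g⁻¹ p.1| + |R g⁻¹ p.2| ≤ C
  integral_bound : ∃ C : ℝ≥0, 0 < C ∧ ∀ n,
    (∀ᵐ b' ∂ν, ∫⁻ b, ∑' g, (Υ n g b b' : ℝ≥0∞) ∂ν ≤ C) ∧
    (∀ᵐ b' ∂ν, ∫⁻ b, ∑' g, (Υ n g b (g • b') : ℝ≥0∞) * rnDerivAction ν g b' ∂ν ≤ C) ∧
    (∀ᵐ b ∂ν, ∫⁻ b', ∑' g, (Υ n g (g • b) b' : ℝ≥0∞) * rnDerivAction ν g b ∂ν ≤ C)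

/-- The measure `ζ_n` on `ℝ`; see `zeta_apply` for its values. -/
def zeta {Γ : Type*} [Group Γ] {B : Type*} [MeasurableSpace B]
    (ν : Measure B) (R : Γ → B → ℝ) (Υ : ℕ → Γ → B → B → ℝ≥0) (n : ℕ) : Measure ℝ :=
  Measure.sum fun g : Γ =>
    ((ν.prod ν).withDensity fun p => (Υ n g p.1 p.2 : ℝ≥0∞)).map
      fun p => R g⁻¹ p.2 - R g⁻¹ p.1

section

variable {Γ : Type*} [Group Γ] {B : Type*} [MetricSpace B] [MeasurableSpace B]
  [MulAction Γ B] {ν : Measure B} [IsProbabilityMeasure ν] {R : Γ → B → ℝ}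
  {Υ : ℕ → Γ → B → B → ℝ≥0}

/-- `ζ_n(E) = ∑_g ∬ 1_E(R(g⁻¹,b') - R(g⁻¹,b)) Υ_n(g,b,b') dν(b') dν(b)`. -/
theorem zeta_apply (hR : IsLogRNCocycle ν R) (hΥ : IsAdmissibleFamily ν R Υ) (n : ℕ)
    {E : Set ℝ} (hE : MeasurableSet E) :
    zeta ν R Υ n E = ∑' g : Γ, ∫⁻ b, ∫⁻ b',
      E.indicator 1 (R g⁻¹ b' - R g⁻¹ b) * (Υ n g b b' : ℝ≥0∞) ∂ν ∂ν := by
  rw [zeta, Measure.sum_apply _ hE]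
  congr 1
  ext g
  have hm : Measurable fun p : B × B => R g⁻¹ p.2 - R g⁻¹ p.1 :=
    ((hR.measurable _).comp measurable_snd).sub ((hR.measurable _).comp measurable_fst)
  have hu : Measurable fun p : B × B => (Υ n g p.1 p.2 : ℝ≥0∞) :=
    (hΥ.measurable n g).coe_nnreal_ennreal
  have hi : Measurable (E.indicator (1 : ℝ → ℝ≥0∞)) := measurable_one.indicator hE
  rw [Measure.map_apply hm hE, withDensity_apply _ (hm hE), ← lintegral_indicator (hm hE)]
  have h2 : ((fun p : B × B => R g⁻¹ p.2 - R g⁻¹ p.1) ⁻¹' E).indicator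
      (fun p => (Υ n g p.1 p.2 : ℝ≥0∞)) =
      fun p => E.indicator 1 (R g⁻¹ p.2 - R g⁻¹ p.1) * (Υ n g p.1 p.2 : ℝ≥0∞) := by
    ext p
    by_cases h : R g⁻¹ p.2 - R g⁻¹ p.1 ∈ E <;> simp [Set.indicator, h]
  rw [h2]
  exact lintegral_prod _ ((hi.comp hm).mul hu).aemeasurable

theorem isProbabilityMeasure_zeta [Countable Γ] (hR : IsLogRNCocycle ν R)
    (hΥ : IsAdmissibleFamily ν R Υ) (n : ℕ) : IsProbabilityMeasure (zeta ν R Υ n) := by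
  constructor
  rw [zeta_apply hR hΥ n MeasurableSet.univ]
  simp only [Set.indicator_univ, Pi.one_apply, one_mul]
  rw [← lintegral_tsum]
  · simp [hΥ.sum_eq_one n]
  · intro g
    exact ((hΥ.measurable n g).coe_nnreal_ennreal.lintegral_prod_right').aemeasurable

/-- `ζ_n` as a point of the space of Borel probability measures on `ℝ` with the weak topology. -/
def zetaProb [Countable Γ] (hR : IsLogRNCocycle ν R) (hΥ : IsAdmissibleFamily ν R Υ) (n : ℕ) :
    ProbabilityMeasure ℝ :=
  ⟨zeta ν R Υ n, isProbabilityMeasure_zeta hR hΥ n⟩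

end

end NonsingularAction

end

/-!
Let `A ⊆ B × X` have positive measure and suppose that no return `p ↦ g • p` to `A` has `R g` close
to `T`. In the Maharam extension of the action, where `g` translates a real coordinate by `R g`, the
union of the translates of `A ×` (a short interval) is an invariant set, and it is disjoint from its
own translate by numbers close to `T` in the real direction. The kernels `Υ n` couple `ν` with
itself along the diagonal, both before and after applying `g⁻¹`, so the sections of the invariant
set over `b` and `b'`, and over `g⁻¹ b` and `g⁻¹ b'`, nearly coincide. By invariance the second pair
differs from the first by a translation by `R(g⁻¹, b') - R(g⁻¹, b)`; on the part of the coupling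
where this number is close to `T` the sections would also be nearly disjoint, so that part has
vanishing mass and `T` cannot lie in the support of a limit of `ζ n`. Hence every set of
positive measure has returns with `R g` close to `T`, that is, `exp T` belongs to the ratio set. For
weakly mixing actions, the ergodic decomposition of `μ` reduces arbitrary `B × X` to ergodic ones.
-/

noncomputable section

namespace NonsingularAction

open ProbabilityTheory

/-- A sequence of measures on `B × B` whose marginals are uniformly dominated by `ν` and which
concentrate on the diagonal. The distance need not be measurable for the product `σ`-algebra. -/
structure IsAsymptoticallyDiagonal {B : Type*} [PseudoMetricSpace B] [MeasurableSpace B]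
    (ν : Measure B) (π : ℕ → Measure (B × B)) : Prop where
  marginals_le : ∃ C : ℝ≥0, ∀ n, (π n).fst ≤ C • ν ∧ (π n).snd ≤ C • ν
  dist_le : ∃ β : ℕ → ℝ, Tendsto β atTop (𝓝 0) ∧ ∀ n, ∀ᵐ p ∂π n, dist p.1 p.2 ≤ β n

section AsymptoticallyDiagonal

variable {B Y : Type*} [MeasurableSpace B] [MeasurableSpace Y]

theorem measurable_measure_symmDiff_section (l : Measure Y) [SFinite l] {W : Set (B × Y)}
    (hW : MeasurableSet W) :
    Measurable fun p : B × B => l (symmDiff (Prod.mk p.1 ⁻¹' W) (Prod.mk p.2 ⁻¹' W)) := by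
  have hV : MeasurableSet (symmDiff ((fun q : (B × B) × Y => (q.1.1, q.2)) ⁻¹' W)
      ((fun q : (B × B) × Y => (q.1.2, q.2)) ⁻¹' W)) :=
    (hW.preimage (by fun_prop)).symmDiff (hW.preimage (by fun_prop))
  exact measurable_measure_prodMk_left hV

theorem lintegral_measure_symmDiff_section_le (l : Measure Y) [SFinite l] {ν : Measure B}
    {π : Measure (B × B)} {C : ℝ≥0} (hfst : π.fst ≤ C • ν) (hsnd : π.snd ≤ C • ν) {W : Set (B × Y)}
    (hW : MeasurableSet W) :
    ∫⁻ p, l (symmDiff (Prod.mk p.1 ⁻¹' W) (Prod.mk p.2 ⁻¹' W)) ∂π ≤ 2 * C * ν.prod l W := by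
  have hm : Measurable fun b => l (Prod.mk b ⁻¹' W) := measurable_measure_prodMk_left hW
  calc _ ≤ ∫⁻ p, (l (Prod.mk p.1 ⁻¹' W) + l (Prod.mk p.2 ⁻¹' W)) ∂π :=
        lintegral_mono fun p => (measure_mono symmDiff_le_sup).trans (measure_union_le _ _)
    _ = ∫⁻ b, l (Prod.mk b ⁻¹' W) ∂π.fst + ∫⁻ b, l (Prod.mk b ⁻¹' W) ∂π.snd := by
        rw [lintegral_add_left (hm.fun_comp measurable_fst), Measure.fst, Measure.snd,
          lintegral_map hm measurable_fst, lintegral_map hm measurable_snd]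
    _ ≤ ∫⁻ b, l (Prod.mk b ⁻¹' W) ∂(C • ν) + ∫⁻ b, l (Prod.mk b ⁻¹' W) ∂(C • ν) :=
        add_le_add (lintegral_mono' hfst le_rfl) (lintegral_mono' hsnd le_rfl)
    _ = 2 * C * ν.prod l W := by
        rw [lintegral_smul_measure, ← Measure.prod_apply hW, ENNReal.smul_def, smul_eq_mul]
        ring

theorem exists_thickening_sdiff_lt [PseudoMetricSpace B] [BorelSpace B] (ν : Measure B)
    [IsFiniteMeasure ν] {S : Set B} (hS : MeasurableSet S) {ε : ℝ≥0∞} (hε : ε ≠ 0) :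
    ∃ F ⊆ S, IsClosed F ∧ ∃ δ > 0, ν (S \ F ∪ Metric.thickening δ F \ F) < ε := by
  obtain ⟨F, hFS, hF, hSF⟩ := hS.exists_isClosed_sdiff_lt (measure_ne_top ν S)
    (ENNReal.half_pos hε).ne'
  have hlt : ν F < ν F + ε / 2 :=
    ENNReal.lt_add_right (measure_ne_top ν F) (ENNReal.half_pos hε).ne'
  obtain ⟨δ, hδF, hδ⟩ := (((tendsto_measure_thickening_of_isClosed
    ⟨1, one_pos, measure_ne_top ν _⟩ hF).eventually_lt_const hlt).and self_mem_nhdsWithin).exists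
  refine ⟨F, hFS, hF, δ, hδ, (measure_union_le _ _).trans_lt ?_⟩
  rw [measure_sdiff (Metric.self_subset_thickening hδ F) hF.measurableSet.nullMeasurableSet
    (measure_ne_top ν F), ← ENNReal.add_halves ε]
  exact ENNReal.add_lt_add hSF (ENNReal.sub_lt_of_lt_add
    (measure_mono (Metric.self_subset_thickening hδ F)) (by rwa [add_comm]))

namespace IsAsymptoticallyDiagonal

variable [PseudoMetricSpace B] {ν : Measure B} {π : ℕ → Measure (B × B)}

theorem tendsto_measure_symmDiff [BorelSpace B] [IsFiniteMeasure ν]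
    (hπ : IsAsymptoticallyDiagonal ν π) {S : Set B} (hS : MeasurableSet S) :
    Tendsto (fun n => π n (symmDiff (Prod.fst ⁻¹' S) (Prod.snd ⁻¹' S))) atTop (𝓝 0) := by
  obtain ⟨C, hC⟩ := hπ.marginals_le
  obtain ⟨β, hβ, hdist⟩ := hπ.dist_le
  rw [ENNReal.tendsto_nhds_zero]
  intro ε hε
  obtain ⟨F, hFS, hF, δ, hδ, hG⟩ := exists_thickening_sdiff_lt ν hS
    (ENNReal.div_pos hε.ne' (by finiteness : (2 * C : ℝ≥0∞) ≠ ∞)).ne'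
  set G := S \ F ∪ Metric.thickening δ F \ F
  have hGm : MeasurableSet G := (hS.diff hF.measurableSet).union
    (Metric.isOpen_thickening.measurableSet.diff hF.measurableSet)
  filter_upwards [hβ.eventually_lt_const hδ] with n hn
  have hsub : symmDiff (Prod.fst ⁻¹' S) (Prod.snd ⁻¹' S) ≤ᵐ[π n]
      (Prod.fst ⁻¹' G ∪ Prod.snd ⁻¹' G : Set (B × B)) := by
    filter_upwards [hdist n] with p hp hpS
    have h₁ : p.1 ∈ F → p.2 ∈ Metric.thickening δ F := fun h =>
      Metric.mem_thickening_iff.2 ⟨p.1, h, by rw [dist_comm]; exact hp.trans_lt hn⟩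
    have h₂ : p.2 ∈ F → p.1 ∈ Metric.thickening δ F := fun h =>
      Metric.mem_thickening_iff.2 ⟨p.2, h, hp.trans_lt hn⟩
    have h₃ := @hFS p.1
    have h₄ := @hFS p.2
    change p.1 ∈ S ∧ p.2 ∉ S ∨ p.2 ∈ S ∧ p.1 ∉ S at hpS
    change (p.1 ∈ S ∧ p.1 ∉ F ∨ _ ∧ p.1 ∉ F) ∨ (p.2 ∈ S ∧ p.2 ∉ F ∨ _ ∧ p.2 ∉ F)
    tauto
  calc π n (symmDiff (Prod.fst ⁻¹' S) (Prod.snd ⁻¹' S))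
      ≤ (π n).fst G + (π n).snd G := by
        rw [Measure.fst_apply hGm, Measure.snd_apply hGm]
        exact (measure_mono_ae hsub).trans (measure_union_le _ _)
    _ ≤ C * ν G + C * ν G := add_le_add ((hC n).1 G) ((hC n).2 G)
    _ = 2 * C * ν G := by ring
    _ ≤ ε := ENNReal.mul_le_of_le_div' hG.le

theorem tendsto_lintegral_measure_symmDiff_iUnion [IsFiniteMeasure ν]
    (hπ : IsAsymptoticallyDiagonal ν π) (l : Measure Y) [IsFiniteMeasure l] {W : ℕ → Set (B × Y)}
    (hdisj : Pairwise (Function.onFun Disjoint W)) (hW : ∀ i, MeasurableSet (W i))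
    (h : ∀ i, Tendsto (fun n => ∫⁻ p, l (symmDiff (Prod.mk p.1 ⁻¹' W i) (Prod.mk p.2 ⁻¹' W i))
      ∂π n) atTop (𝓝 0)) :
    Tendsto (fun n => ∫⁻ p, l (symmDiff (Prod.mk p.1 ⁻¹' ⋃ i, W i) (Prod.mk p.2 ⁻¹' ⋃ i, W i))
      ∂π n) atTop (𝓝 0) := by
  obtain ⟨C, hC⟩ := hπ.marginals_le
  have hsum : Tendsto (fun n => ∫⁻ i, ∫⁻ p, l (symmDiff (Prod.mk p.1 ⁻¹' W i)
      (Prod.mk p.2 ⁻¹' W i)) ∂π n ∂Measure.count) atTop (𝓝 (∫⁻ _ : ℕ, 0 ∂Measure.count)) := by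
    refine tendsto_lintegral_of_dominated_convergence (fun i => 2 * C * ν.prod l (W i))
      (fun n => measurable_of_countable _) (fun n => Eventually.of_forall fun i =>
        lintegral_measure_symmDiff_section_le l (hC n).1 (hC n).2 (hW i)) ?_
      (Eventually.of_forall h)
    rw [lintegral_count, ENNReal.tsum_mul_left, ← measure_iUnion hdisj hW]
    finiteness
  simp only [lintegral_zero, lintegral_count] at hsum
  refine tendsto_of_tendsto_of_tendsto_of_le_of_le tendsto_const_nhds hsum
    (fun _ => zero_le) fun n => ?_
  dsimp only
  rw [← lintegral_tsum fun i => (measurable_measure_symmDiff_section l (hW i)).aemeasurable]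
  refine lintegral_mono fun p => (measure_mono ?_).trans (measure_iUnion_le _)
  simpa only [Set.preimage_iUnion] using Set.iUnion_symmDiff_iUnion_subset

theorem tendsto_lintegral_measure_symmDiff_section [BorelSpace B] [IsFiniteMeasure ν]
    (hπ : IsAsymptoticallyDiagonal ν π) (l : Measure Y) [IsFiniteMeasure l] {W : Set (B × Y)}
    (hW : MeasurableSet W) :
    Tendsto (fun n => ∫⁻ p, l (symmDiff (Prod.mk p.1 ⁻¹' W) (Prod.mk p.2 ⁻¹' W)) ∂π n)
      atTop (𝓝 0) := by
  induction W, hW using MeasurableSpace.induction_on_inter generateFrom_prod.symm isPiSystem_prod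
  with
  | empty => simp
  | basic _ hST =>
    obtain ⟨S, hS, T, -, rfl⟩ := hST
    have hint : ∀ n, ∫⁻ p, l (symmDiff (Prod.mk p.1 ⁻¹' S ×ˢ T) (Prod.mk p.2 ⁻¹' S ×ˢ T)) ∂π n =
        l T * π n (symmDiff (Prod.fst ⁻¹' S) (Prod.snd ⁻¹' S)) := fun n => by
      rw [← lintegral_indicator_const
        ((measurable_fst hS).symmDiff (measurable_snd hS)) (l T)]
      refine lintegral_congr fun p => ?_
      by_cases h₁ : p.1 ∈ S <;> by_cases h₂ : p.2 ∈ S <;>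
        simp [Set.indicator, Set.symmDiff_def, h₁, h₂]
    simp_rw [hint]
    simpa using ENNReal.Tendsto.const_mul (hπ.tendsto_measure_symmDiff hS)
      (Or.inr (measure_ne_top l T))
  | compl W _ ih => simpa only [Set.preimage_compl, compl_symmDiff_compl] using ih
  | iUnion W hdisj hW ih => exact hπ.tendsto_lintegral_measure_symmDiff_iUnion l hdisj hW ih

end IsAsymptoticallyDiagonal

end AsymptoticallyDiagonal

section Nonsingular

variable {Γ B X : Type*} [Group Γ] [MeasurableSpace B] [MulAction Γ B] {ν : Measure B}
  [MeasurableSpace X] [MulAction Γ X] {μ : Measure X}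

instance instMeasurableConstSMulProd [MeasurableConstSMul Γ B] [MeasurableConstSMul Γ X] :
    MeasurableConstSMul Γ (B × X) :=
  ⟨fun g => (measurable_const_smul g).prodMap (measurable_const_smul g)⟩

theorem measurable_rnDerivAction (g : Γ) : Measurable (rnDerivAction ν g) :=
  Measure.measurable_rnDeriv _ _

theorem IsMeasurePreserving.isNonsingular (hμ : IsMeasurePreserving Γ μ) : IsNonsingular Γ μ :=
  fun g => (hμ g).quasiMeasurePreserving

namespace IsNonsingular

theorem measurableConstSMul (hν : IsNonsingular Γ ν) : MeasurableConstSMul Γ B :=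
  ⟨fun g => (hν g).measurable⟩

theorem prod [SFinite ν] [SFinite μ] (hν : IsNonsingular Γ ν) (hμ : IsNonsingular Γ μ) :
    IsNonsingular Γ (ν.prod μ) := fun g => by
  refine ⟨(hν g).measurable.prodMap (hμ g).measurable, ?_⟩
  change (ν.prod μ).map (Prod.map (fun b : B => g • b) (fun x : X => g • x)) ≪ _
  rw [← Measure.map_prod_map ν μ (hν g).measurable (hμ g).measurable]
  exact (hν g).absolutelyContinuous.prod (hμ g).absolutelyContinuous

variable [IsFiniteMeasure ν]

theorem map_inv_smul (hν : IsNonsingular Γ ν) (g : Γ) :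
    ν.map (fun b => g⁻¹ • b) = ν.withDensity (rnDerivAction ν g) :=
  (Measure.withDensity_rnDeriv_eq _ _ (hν g⁻¹).absolutelyContinuous).symm

theorem map_inv_smul_withDensity (hν : IsNonsingular Γ ν) (g : Γ) {u : B → ℝ≥0∞}
    (hu : Measurable u) :
    (ν.withDensity u).map (fun b => g⁻¹ • b) =
      ν.withDensity fun b => u (g • b) * rnDerivAction ν g b := by
  have hug : Measurable fun b => u (g • b) := hu.comp (hν g).measurable
  ext E hE
  have hgE : MeasurableSet ((fun b => g⁻¹ • b) ⁻¹' E) := (hν g⁻¹).measurable hE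
  calc (ν.withDensity u).map (fun b => g⁻¹ • b) E
      = ∫⁻ b in (fun b => g⁻¹ • b) ⁻¹' E, u (g • g⁻¹ • b) ∂ν := by
        rw [Measure.map_apply (hν g⁻¹).measurable hE, withDensity_apply _ hgE]
        simp only [smul_inv_smul]
    _ = ∫⁻ b in E, u (g • b) ∂ν.withDensity (rnDerivAction ν g) := by
        rw [← hν.map_inv_smul, setLIntegral_map hE hug (hν g⁻¹).measurable]
    _ = _ := by
        rw [setLIntegral_withDensity_eq_setLIntegral_mul _ (measurable_rnDerivAction g) hug hE,
          withDensity_apply _ hE]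
        simp only [Pi.mul_apply, mul_comm]

theorem rnDerivAction_pos (hν : IsNonsingular Γ ν) (g : Γ) :
    ∀ᵐ b ∂ν, 0 < rnDerivAction ν g b := by
  refine Measure.rnDeriv_pos' ?_
  have h := (hν g).absolutelyContinuous.map (hν g⁻¹).measurable
  rw [Measure.map_map (hν g⁻¹).measurable (hν g).measurable] at h
  simpa [Function.comp_def] using h

theorem rnDerivAction_prod [IsFiniteMeasure μ] (hν : IsNonsingular Γ ν)
    (hμ : IsMeasurePreserving Γ μ) (g : Γ) :
    rnDerivAction (ν.prod μ) g =ᵐ[ν.prod μ] fun p => rnDerivAction ν g p.1 := by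
  have hmap : (ν.prod μ).map (Prod.map (fun b : B => g⁻¹ • b) (fun x : X => g⁻¹ • x)) =
      (ν.prod μ).withDensity fun p => rnDerivAction ν g p.1 := by
    rw [← Measure.map_prod_map ν μ (hν g⁻¹).measurable (hμ g⁻¹).measurable, (hμ g⁻¹).map_eq,
      hν.map_inv_smul, prod_withDensity_left (measurable_rnDerivAction g)]
  change Measure.rnDeriv (Measure.map (Prod.map _ _) _) _ =ᵐ[_] _
  rw [hmap]
  exact Measure.rnDeriv_withDensity _ ((measurable_rnDerivAction g).comp measurable_fst)

end IsNonsingular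

namespace IsLogRNCocycle

variable {R : Γ → B → ℝ}

theorem map_one (hR : IsLogRNCocycle ν R) (b : B) : R 1 b = 0 := by
  simpa using hR.cocycle 1 1 b

theorem prod [IsFiniteMeasure ν] [IsFiniteMeasure μ] (hR : IsLogRNCocycle ν R)
    (hν : IsNonsingular Γ ν) (hμ : IsMeasurePreserving Γ μ) :
    IsLogRNCocycle (ν.prod μ) fun g p => R g p.1 where
  measurable g := (hR.measurable g).comp measurable_fst
  cocycle g₂ g₁ p := hR.cocycle g₂ g₁ p.1
  ae_eq g := by
    filter_upwards [hν.rnDerivAction_prod hμ g,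
      Measure.quasiMeasurePreserving_fst.ae (hR.ae_eq g)] with p hp hRp
    rw [hp, hRp]

theorem toReal_rnDerivAction [IsFiniteMeasure ν] (hR : IsLogRNCocycle ν R)
    (hν : IsNonsingular Γ ν) (g : Γ) :
    ∀ᵐ b ∂ν, (rnDerivAction ν g b).toReal = Real.exp (R g b) := by
  filter_upwards [hν.rnDerivAction_pos g, hR.ae_eq g,
    Measure.rnDeriv_ne_top (ν.map fun b : B => g⁻¹ • b) ν] with b hpos hRb htop
  rw [hRb, Real.exp_log (ENNReal.toReal_pos hpos.ne' htop)]

end IsLogRNCocycle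

end Nonsingular

section Marginals

variable {ι B X : Type*} [MeasurableSpace B] [MeasurableSpace X] {ν : Measure B} {μ : Measure X}

theorem fst_withDensity_prod [SFinite ν] [SFinite μ] {f : B × X → ℝ≥0∞} (hf : Measurable f) :
    ((ν.prod μ).withDensity f).fst = ν.withDensity fun b => ∫⁻ x, f (b, x) ∂μ := by
  ext E hE
  rw [Measure.fst_apply hE, withDensity_apply _ (measurable_fst hE), withDensity_apply _ hE,
    ← Set.prod_univ, setLIntegral_prod _ hf.aemeasurable, Measure.restrict_univ]

theorem snd_withDensity_prod [SFinite ν] [SFinite μ] {f : B × X → ℝ≥0∞} (hf : Measurable f) :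
    ((ν.prod μ).withDensity f).snd = μ.withDensity fun x => ∫⁻ b, f (b, x) ∂ν := by
  ext E hE
  rw [Measure.snd_apply hE, withDensity_apply _ (measurable_snd hE), withDensity_apply _ hE,
    ← Set.univ_prod, setLIntegral_prod_symm _ hf.aemeasurable, Measure.restrict_univ]

theorem sum_withDensity_le_smul [Countable ι] {u : ι → B → ℝ≥0∞} (hu : ∀ i, Measurable (u i))
    {C : ℝ≥0} (hC : ∀ᵐ b ∂ν, ∑' i, u i b ≤ C) :
    Measure.sum (fun i => ν.withDensity (u i)) ≤ C • ν := by
  rw [← withDensity_tsum hu, ENNReal.smul_def, ← withDensity_const]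
  refine withDensity_mono ?_
  filter_upwards [hC] with b hb
  rwa [ENNReal.tsum_apply]

end Marginals

section Coupling

variable {Γ B : Type*} [Group Γ] [MeasurableSpace B] [MulAction Γ B]

/-- The measure `Υ_n(g, ·, ·) d(ν × ν)` on `B × B`. -/
def jointMeasure (ν : Measure B) (Υ : ℕ → Γ → B → B → ℝ≥0) (n : ℕ) (g : Γ) : Measure (B × B) :=
  (ν.prod ν).withDensity fun p => (Υ n g p.1 p.2 : ℝ≥0∞)

/-- The law of `(b, b')` when `(g, b, b')` is chosen according to `Υ_n`. -/
def coupling (ν : Measure B) (Υ : ℕ → Γ → B → B → ℝ≥0) (n : ℕ) : Measure (B × B) :=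
  Measure.sum (jointMeasure ν Υ n)

/-- The law of `(g⁻¹ b, g⁻¹ b')` when `(g, b, b')` is chosen according to `Υ_n`. -/
def translatedCoupling (ν : Measure B) (Υ : ℕ → Γ → B → B → ℝ≥0) (n : ℕ) : Measure (B × B) :=
  Measure.sum fun g => (jointMeasure ν Υ n g).map fun p => g⁻¹ • p

end Coupling

namespace IsAdmissibleFamily

variable {Γ B : Type*} [Group Γ] [Countable Γ] [MetricSpace B] [MeasurableSpace B] [MulAction Γ B]
  {ν : Measure B} [IsFiniteMeasure ν] {R : Γ → B → ℝ} {Υ : ℕ → Γ → B → B → ℝ≥0}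

omit [Countable Γ] [IsFiniteMeasure ν] in
theorem measurable_coe (hΥ : IsAdmissibleFamily ν R Υ) (n : ℕ) (g : Γ) :
    Measurable fun p : B × B => (Υ n g p.1 p.2 : ℝ≥0∞) :=
  (hΥ.measurable n g).coe_nnreal_ennreal

theorem fst_coupling (hΥ : IsAdmissibleFamily ν R Υ) (n : ℕ) : (coupling ν Υ n).fst = ν := by
  have hm := hΥ.measurable_coe n
  simp only [coupling, jointMeasure, Measure.fst_sum, fst_withDensity_prod (hm _)]
  rw [← withDensity_tsum fun g => (hm g).lintegral_prod_right']
  have hone : ∑' g, (fun b => ∫⁻ b', (Υ n g b b' : ℝ≥0∞) ∂ν) = 1 := by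
    ext b
    rw [ENNReal.tsum_apply, hΥ.sum_eq_one n b, Pi.one_apply]
  rw [hone, withDensity_one]

theorem snd_coupling_le (hΥ : IsAdmissibleFamily ν R Υ) {n : ℕ} {C : ℝ≥0}
    (hC : ∀ᵐ b' ∂ν, ∫⁻ b, ∑' g, (Υ n g b b' : ℝ≥0∞) ∂ν ≤ C) : (coupling ν Υ n).snd ≤ C • ν := by
  have hm := hΥ.measurable_coe n
  simp only [coupling, jointMeasure, Measure.snd_sum, snd_withDensity_prod (hm _)]
  refine sum_withDensity_le_smul (fun g => (hm g).lintegral_prod_left') ?_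
  filter_upwards [hC] with b' hb'
  rwa [lintegral_tsum fun g => ((hm g).fun_comp measurable_prodMk_right).aemeasurable] at hb'

theorem fst_translatedCoupling_le (hΥ : IsAdmissibleFamily ν R Υ) (hν : IsNonsingular Γ ν)
    {n : ℕ} {C : ℝ≥0}
    (hC : ∀ᵐ b ∂ν, ∫⁻ b', ∑' g, (Υ n g (g • b) b' : ℝ≥0∞) * rnDerivAction ν g b ∂ν ≤ C) :
    (translatedCoupling ν Υ n).fst ≤ C • ν := by
  have hm := hΥ.measurable_coe n
  have := hν.measurableConstSMul
  have hfst : ∀ g, ((jointMeasure ν Υ n g).map fun p => g⁻¹ • p).fst =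
      ν.withDensity fun b => (∫⁻ b', (Υ n g (g • b) b' : ℝ≥0∞) ∂ν) * rnDerivAction ν g b := by
    intro g
    rw [← hν.map_inv_smul_withDensity g (hm g).lintegral_prod_right', ← fst_withDensity_prod (hm g),
      Measure.fst, Measure.fst, Measure.map_map measurable_fst (measurable_const_smul _),
      Measure.map_map (measurable_const_smul _) measurable_fst]
    rfl
  simp only [translatedCoupling, Measure.fst_sum, hfst]
  refine sum_withDensity_le_smul (fun g => ((hm g).lintegral_prod_right'.fun_comp
    (measurable_const_smul g)).fun_mul (measurable_rnDerivAction g)) ?_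
  filter_upwards [hC] with b hb
  have hmb : ∀ g, Measurable fun b' => (Υ n g (g • b) b' : ℝ≥0∞) := fun g =>
    (hm g).comp measurable_prodMk_left
  simpa only [lintegral_tsum fun g => ((hmb g).mul_const _).aemeasurable,
    lintegral_mul_const _ (hmb _)] using hb

theorem snd_translatedCoupling_le (hΥ : IsAdmissibleFamily ν R Υ) (hν : IsNonsingular Γ ν)
    {n : ℕ} {C : ℝ≥0}
    (hC : ∀ᵐ b' ∂ν, ∫⁻ b, ∑' g, (Υ n g b (g • b') : ℝ≥0∞) * rnDerivAction ν g b' ∂ν ≤ C) :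
    (translatedCoupling ν Υ n).snd ≤ C • ν := by
  have hm := hΥ.measurable_coe n
  have := hν.measurableConstSMul
  have hsnd : ∀ g, ((jointMeasure ν Υ n g).map fun p => g⁻¹ • p).snd =
      ν.withDensity fun b' => (∫⁻ b, (Υ n g b (g • b') : ℝ≥0∞) ∂ν) * rnDerivAction ν g b' := by
    intro g
    rw [← hν.map_inv_smul_withDensity g (hm g).lintegral_prod_left', ← snd_withDensity_prod (hm g),
      Measure.snd, Measure.snd, Measure.map_map measurable_snd (measurable_const_smul _),
      Measure.map_map (measurable_const_smul _) measurable_snd]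
    rfl
  simp only [translatedCoupling, Measure.snd_sum, hsnd]
  refine sum_withDensity_le_smul (fun g => ((hm g).lintegral_prod_left'.fun_comp
    (measurable_const_smul g)).fun_mul (measurable_rnDerivAction g)) ?_
  filter_upwards [hC] with b' hb'
  have hmb' : ∀ g, Measurable fun b => (Υ n g b (g • b') : ℝ≥0∞) := fun g =>
    (hm g).comp measurable_prodMk_right
  simpa only [lintegral_tsum fun g => ((hmb' g).mul_const _).aemeasurable,
    lintegral_mul_const _ (hmb' _)] using hb'

omit [Countable Γ] [IsFiniteMeasure ν] in
theorem ae_jointMeasure_iff (hΥ : IsAdmissibleFamily ν R Υ) {n : ℕ} {g : Γ} {P : B × B → Prop} :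
    (∀ᵐ p ∂jointMeasure ν Υ n g, P p) ↔ ∀ᵐ p ∂ν.prod ν, 0 < Υ n g p.1 p.2 → P p := by
  simp only [jointMeasure, ae_withDensity_iff (hΥ.measurable_coe n g), ne_eq,
    ENNReal.coe_eq_zero, pos_iff_ne_zero]

theorem isAsymptoticallyDiagonal_coupling (hΥ : IsAdmissibleFamily ν R Υ) :
    IsAsymptoticallyDiagonal ν (coupling ν Υ) := by
  obtain ⟨C, -, hC⟩ := hΥ.integral_bound
  obtain ⟨β, hβ, hdist⟩ := hΥ.dist_le
  refine ⟨⟨C + 1, fun n => ⟨?_, ?_⟩⟩, β, hβ, fun n => ?_⟩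
  · rw [hΥ.fst_coupling, add_smul, one_smul]
    exact Measure.le_add_left le_rfl
  · refine (hΥ.snd_coupling_le (hC n).1).trans ?_
    rw [add_smul, one_smul]
    exact Measure.le_add_right le_rfl
  · exact Measure.ae_sum_iff.2 fun g => hΥ.ae_jointMeasure_iff.2 <|
      Eventually.of_forall fun p hp => (hdist n g _ _ hp).1

theorem isAsymptoticallyDiagonal_translatedCoupling (hΥ : IsAdmissibleFamily ν R Υ)
    (hν : IsNonsingular Γ ν) : IsAsymptoticallyDiagonal ν (translatedCoupling ν Υ) := by
  have := hν.measurableConstSMul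
  obtain ⟨C, -, hC⟩ := hΥ.integral_bound
  obtain ⟨β, hβ, hdist⟩ := hΥ.dist_le
  refine ⟨⟨C, fun n => ⟨hΥ.fst_translatedCoupling_le hν (hC n).2.2,
    hΥ.snd_translatedCoupling_le hν (hC n).2.1⟩⟩, β, hβ, fun n => Measure.ae_sum_iff.2 fun g => ?_⟩
  rw [(measurableEmbedding_const_smul g⁻¹).ae_map_iff, hΥ.ae_jointMeasure_iff]
  exact Eventually.of_forall fun p hp => (hdist n g _ _ hp).2

end IsAdmissibleFamily

/-- The density `(1 + t²)⁻¹` changes at most by a bounded factor under bounded translations. -/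
theorem exists_isFiniteMeasure_map_add_right_le :
    ∃ ρ : Measure ℝ, IsFiniteMeasure ρ ∧ volume ≪ ρ ∧
      ∀ C : ℝ, ∃ K : ℝ≥0, ∀ s, |s| ≤ C → ρ.map (fun t => t + s) ≤ K • ρ := by
  have hm : Measurable fun t : ℝ => ENNReal.ofReal (1 + t ^ 2)⁻¹ := by fun_prop
  refine ⟨volume.withDensity fun t => ENNReal.ofReal (1 + t ^ 2)⁻¹,
    isFiniteMeasure_withDensity_ofReal integrable_inv_one_add_sq.2,
    withDensity_absolutelyContinuous' hm.aemeasurable (Eventually.of_forall fun t =>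
      (ENNReal.ofReal_pos.2 (by positivity)).ne'),
    fun C => ⟨Real.toNNReal (2 * (1 + C ^ 2)), fun s hs => Measure.le_iff.2 fun E hE => ?_⟩⟩
  have hms : Measurable fun t : ℝ => ENNReal.ofReal (1 + (t - s) ^ 2)⁻¹ := by fun_prop
  have hdens : ∀ t : ℝ, (1 + (t - s) ^ 2)⁻¹ ≤ 2 * (1 + C ^ 2) * (1 + t ^ 2)⁻¹ := fun t => by
    have hsC : s ^ 2 ≤ C ^ 2 := sq_le_sq' (abs_le.1 hs).1 (abs_le.1 hs).2
    rw [← div_eq_mul_inv, inv_le_comm₀ (by positivity) (by positivity), inv_div,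
      div_le_iff₀ (by positivity)]
    nlinarith [sq_nonneg (t - 2 * s), mul_nonneg (sub_nonneg.2 hsC) (sq_nonneg (t - s)),
      sq_nonneg (s * (t - s))]
  rw [Measure.map_apply (measurable_add_const s) hE,
    withDensity_apply _ (measurable_add_const s hE), Measure.smul_apply, withDensity_apply _ hE]
  calc ∫⁻ t in (fun t => t + s) ⁻¹' E, ENNReal.ofReal (1 + t ^ 2)⁻¹
      = ∫⁻ t in E, ENNReal.ofReal (1 + (t - s) ^ 2)⁻¹ := by
        simpa only [add_sub_cancel_right] using
          (measurePreserving_add_right volume s).setLIntegral_comp_preimage hE hms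
    _ ≤ ∫⁻ t in E, ENNReal.ofReal (2 * (1 + C ^ 2)) * ENNReal.ofReal (1 + t ^ 2)⁻¹ :=
        lintegral_mono fun t => by
          rw [← ENNReal.ofReal_mul (by positivity)]
          exact ENNReal.ofReal_le_ofReal (hdens t)
    _ = _ := lintegral_const_mul _ hm

/-- The saturation of `A × [0, η)` under the action `g • (p, t) = (g • p, t + R g p)` of the
Maharam extension of the action on `B × X`. -/
def maharamSaturation {Γ B X : Type*} [Group Γ] [MulAction Γ B] [MulAction Γ X]
    (R : Γ → B → ℝ) (A : Set (B × X)) (η : ℝ) : Set (B × (X × ℝ)) :=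
  {q | ∃ g : Γ, g • (q.1, q.2.1) ∈ A ∧ q.2.2 + R g q.1 ∈ Set.Ico 0 η}

section MaharamSaturation

variable {Γ B X : Type*} [Group Γ] [MeasurableSpace B] [MulAction Γ B] {ν : Measure B}
  {R : Γ → B → ℝ} [MulAction Γ X] {A : Set (B × X)}

theorem smul_mem_maharamSaturation_iff (hR : IsLogRNCocycle ν R) {η : ℝ} (h : Γ) {b : B} {x : X}
    {t : ℝ} : (h • b, (h • x, t + R h b)) ∈ maharamSaturation R A η ↔
      (b, (x, t)) ∈ maharamSaturation R A η := by
  refine (Equiv.mulRight h).exists_congr fun g => ?_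
  dsimp only [Equiv.coe_mulRight]
  rw [hR.cocycle g h b, add_assoc, add_comm (R h b), ← Prod.smul_mk, mul_smul]

theorem notMem_maharamSaturation_of_mem (hR : IsLogRNCocycle ν R) {η T : ℝ}
    (hsep : ∀ p ∈ A, ∀ g : Γ, g • p ∈ A → 2 * η ≤ |R g p.1 - T|) {τ : ℝ} (hτ : |τ - T| < η)
    {b : B} {x : X} {t : ℝ} (hmem : (b, (x, t)) ∈ maharamSaturation R A η) :
    (b, (x, t - τ)) ∉ maharamSaturation R A η := by
  obtain ⟨g, hgA, hg₀, hg₁⟩ := hmem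
  rintro ⟨h, hhA, hh₀, hh₁⟩
  have hret := hsep _ hgA (h * g⁻¹) (by simpa [mul_smul] using hhA)
  have hcoc := hR.cocycle (h * g⁻¹) g b
  rw [inv_mul_cancel_right] at hcoc
  dsimp only [Prod.smul_fst] at hg₀ hg₁ hh₀ hh₁ hret
  obtain ⟨hτ₀, hτ₁⟩ := abs_lt.1 hτ
  exact hret.not_gt (abs_lt.2 ⟨by linarith, by linarith⟩)

variable [MeasurableSpace X] {μ : Measure X}

theorem measurableSet_maharamSaturation [Countable Γ] [MeasurableConstSMul Γ B]
    [MeasurableConstSMul Γ X] (hR : IsLogRNCocycle ν R) (hA : MeasurableSet A) (η : ℝ) :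
    MeasurableSet (maharamSaturation R A η) := by
  have hW : maharamSaturation R A η = ⋃ g : Γ,
      (fun q : B × (X × ℝ) => g • (q.1, q.2.1)) ⁻¹' A ∩
        (fun q : B × (X × ℝ) => q.2.2 + R g q.1) ⁻¹' Set.Ico 0 η := by
    ext q
    simp only [maharamSaturation, Set.mem_ofPred_eq, Set.mem_iUnion, Set.mem_inter_iff,
      Set.mem_preimage]
  rw [hW]
  have hRm := hR.measurable
  exact MeasurableSet.iUnion fun g => (hA.preimage (by fun_prop)).inter
    (measurableSet_Ico.preimage (by fun_prop))

theorem ae_measure_section_maharamSaturation_pos [Countable Γ] [MeasurableConstSMul Γ B]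
    [MeasurableConstSMul Γ X] (hR : IsLogRNCocycle ν R) (hA : MeasurableSet A) [NeZero μ]
    [SFinite μ] (hsat : ∀ᵐ p ∂ν.prod μ, ∃ g : Γ, g • p ∈ A) {ρ : Measure ℝ} [SFinite ρ]
    (hρ : volume ≪ ρ) {η : ℝ} (hη : 0 < η) :
    ∀ᵐ b ∂ν, 0 < μ.prod ρ (Prod.mk b ⁻¹' maharamSaturation R A η) := by
  filter_upwards [Measure.ae_ae_of_ae_prod hsat] with b hb
  have hW : MeasurableSet (Prod.mk b ⁻¹' maharamSaturation R A η) :=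
    measurable_prodMk_left (measurableSet_maharamSaturation hR hA η)
  rw [pos_iff_ne_zero, ne_eq, Measure.measure_prod_null hW]
  intro hzero
  obtain ⟨x, ⟨g, hg⟩, hx⟩ := (hb.and hzero).exists
  have hIco : Set.Ico (-R g b) (-R g b + η) ⊆
      Prod.mk x ⁻¹' (Prod.mk b ⁻¹' maharamSaturation R A η) := fun t ht =>
    ⟨g, hg, by dsimp only; linarith [ht.1], by dsimp only; linarith [ht.2]⟩
  have hvol := hρ (measure_mono_null hIco hx)
  rw [Real.volume_Ico, ENNReal.ofReal_eq_zero] at hvol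
  linarith

theorem map_smul_add_prod_le [SFinite μ] {ρ : Measure ℝ} [SFinite ρ]
    (hμ : IsMeasurePreserving Γ μ) (g : Γ) {s : ℝ} {K : ℝ≥0}
    (hs : ρ.map (fun t => t + s) ≤ K • ρ) :
    (μ.prod ρ).map (Prod.map (fun x => g • x) (fun t => t + s)) ≤ K • μ.prod ρ := by
  rw [← Measure.map_prod_map _ _ (hμ g).measurable (measurable_add_const s), (hμ g).map_eq,
    ← Measure.prod_smul_right]
  exact Measure.prod_mono le_rfl hs

/-- The section `W_b` is disjoint from its translate by `τ = R g b' - R g b`. If `b` and `b'` are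
close, then this translate almost agrees with the one of `W_{b'}`; if `g • b` and `g • b'` are
close, then by invariance the latter almost agrees with `W_b`. Hence `W_b` is small. -/
theorem measure_section_maharamSaturation_le [Countable Γ] [MeasurableConstSMul Γ B]
    [SFinite μ] {ρ : Measure ℝ} [SFinite ρ] (hR : IsLogRNCocycle ν R) (hμ : IsMeasurePreserving Γ μ)
    (hA : MeasurableSet A) {η T : ℝ}
    (hsep : ∀ p ∈ A, ∀ g : Γ, g • p ∈ A → 2 * η ≤ |R g p.1 - T|) {C : ℝ} {K : ℝ≥0}
    (hK : ∀ s, |s| ≤ C → ρ.map (fun t => t + s) ≤ K • ρ) {g : Γ} {b b' : B}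
    (hC : |R g b| + |R g b'| ≤ C) (hT : |R g b' - R g b - T| < η) :
    μ.prod ρ (Prod.mk b ⁻¹' maharamSaturation R A η) ≤
      K * (μ.prod ρ (symmDiff (Prod.mk b ⁻¹' maharamSaturation R A η)
          (Prod.mk b' ⁻¹' maharamSaturation R A η)) +
        μ.prod ρ (symmDiff (Prod.mk (g • b) ⁻¹' maharamSaturation R A η)
          (Prod.mk (g • b') ⁻¹' maharamSaturation R A η))) := by
  have := hμ.isNonsingular.measurableConstSMul
  set W := maharamSaturation R A η
  have hW : ∀ b, MeasurableSet (Prod.mk b ⁻¹' W) := fun b =>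
    measurable_prodMk_left (measurableSet_maharamSaturation hR hA η)
  set τ := R g b' - R g b with hτ
  have hτC : |-τ| ≤ C := by
    rw [abs_neg]
    exact (abs_sub _ _).trans (by rwa [add_comm])
  have hsub : Prod.mk b ⁻¹' W ⊆
      Prod.map (fun x => (1 : Γ) • x) (fun t => t + -τ) ⁻¹'
          symmDiff (Prod.mk b ⁻¹' W) (Prod.mk b' ⁻¹' W) ∪
        Prod.map (fun x => g • x) (fun t => t + R g b) ⁻¹'
          symmDiff (Prod.mk (g • b) ⁻¹' W) (Prod.mk (g • b') ⁻¹' W) := by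
    rintro ⟨x, t⟩ hxt
    have hdisj : (b, (x, t - τ)) ∉ W := notMem_maharamSaturation_of_mem hR hsep hT hxt
    have hgb : (g • b, (g • x, t + R g b)) ∈ W := (smul_mem_maharamSaturation_iff hR g).2 hxt
    have hgb' : (g • b', (g • x, t + R g b)) ∈ W ↔ (b', (x, t - τ)) ∈ W := by
      have h := smul_mem_maharamSaturation_iff (A := A) (η := η) hR g (b := b') (x := x)
        (t := t - τ)
      rwa [hτ, show t - (R g b' - R g b) + R g b' = t + R g b by ring] at h
    simp only [Set.mem_union, Set.mem_preimage, Set.mem_symmDiff, Prod.map_apply, one_smul,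
      ← sub_eq_add_neg, hdisj, hgb, hgb']
    tauto
  calc μ.prod ρ (Prod.mk b ⁻¹' W)
      ≤ (μ.prod ρ).map (Prod.map (fun x => (1 : Γ) • x) (fun t => t + -τ))
          (symmDiff (Prod.mk b ⁻¹' W) (Prod.mk b' ⁻¹' W)) +
        (μ.prod ρ).map (Prod.map (fun x => g • x) (fun t => t + R g b))
          (symmDiff (Prod.mk (g • b) ⁻¹' W) (Prod.mk (g • b') ⁻¹' W)) := by
        rw [Measure.map_apply (by fun_prop) ((hW _).symmDiff (hW _)),
          Measure.map_apply (by fun_prop) ((hW _).symmDiff (hW _))]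
        exact (measure_mono hsub).trans (measure_union_le _ _)
    _ ≤ _ := by
        rw [mul_add]
        exact add_le_add (map_smul_add_prod_le hμ 1 (hK _ hτC) _)
          (map_smul_add_prod_le hμ g (hK _ ((le_add_of_nonneg_right (abs_nonneg _)).trans hC)) _)

end MaharamSaturation

theorem tendsto_measure_univ_of_tendsto_lintegral {B ι : Type*} [MeasurableSpace B]
    {ν : Measure B} [IsFiniteMeasure ν] {l : Filter ι} {κ : ι → Measure B} (hκ : ∀ i, κ i ≤ ν)
    {w : B → ℝ≥0∞} (hw : Measurable w) (hpos : ∀ᵐ b ∂ν, 0 < w b)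
    (h : Tendsto (fun i => ∫⁻ b, w b ∂κ i) l (𝓝 0)) :
    Tendsto (fun i => κ i Set.univ) l (𝓝 0) := by
  have hdefect : Tendsto (fun k : ℕ => ∫⁻ b, (1 - k * w b) ∂ν) atTop (𝓝 (∫⁻ _, 0 ∂ν)) := by
    refine tendsto_lintegral_of_dominated_convergence 1 (fun k => by fun_prop)
      (fun k => Eventually.of_forall fun b => tsub_le_self) (by simp) ?_
    filter_upwards [hpos] with b hb
    obtain ⟨k₀, hk₀⟩ := ENNReal.exists_nat_mul_gt hb.ne' ENNReal.one_ne_top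
    refine tendsto_const_nhds.congr' ((eventually_ge_atTop k₀).mono fun k hk => ?_)
    exact (tsub_eq_zero_of_le (hk₀.le.trans (by gcongr))).symm
  rw [lintegral_zero] at hdefect
  rw [ENNReal.tendsto_nhds_zero]
  intro ε hε
  have hε₂ : 0 < ε / 2 := ENNReal.half_pos hε.ne'
  obtain ⟨k, hk⟩ := (hdefect.eventually_lt_const hε₂).exists
  have hkw : Tendsto (fun i => k * ∫⁻ b, w b ∂κ i) l (𝓝 0) := by
    simpa using ENNReal.Tendsto.const_mul h (Or.inr (ENNReal.natCast_ne_top k))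
  filter_upwards [hkw.eventually_lt_const hε₂] with i hi
  calc κ i Set.univ = ∫⁻ _, 1 ∂κ i := lintegral_one.symm
    _ ≤ ∫⁻ b, (k * w b + (1 - k * w b)) ∂κ i := lintegral_mono fun b => le_add_tsub
    _ = k * ∫⁻ b, w b ∂κ i + ∫⁻ b, (1 - k * w b) ∂κ i := by
        rw [lintegral_add_left (by fun_prop), lintegral_const_mul _ hw]
    _ ≤ ε / 2 + ε / 2 := add_le_add hi.le ((lintegral_mono' (hκ i) le_rfl).trans hk.le)
    _ = ε := ENNReal.add_halves ε

section Return

variable {Γ B X : Type*} [Group Γ] [MeasurableSpace B] {ν : Measure B} {R : Γ → B → ℝ}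
  {Υ : ℕ → Γ → B → B → ℝ≥0}

/-- The part of `coupling ν Υ n` coming from the triples `(g, b, b')` with
`R g⁻¹ b' - R g⁻¹ b ∈ E`. -/
def restrictedCoupling (ν : Measure B) (R : Γ → B → ℝ) (Υ : ℕ → Γ → B → B → ℝ≥0) (E : Set ℝ)
    (n : ℕ) : Measure (B × B) :=
  Measure.sum fun g => (jointMeasure ν Υ n g).restrict
    ((fun p => R g⁻¹ p.2 - R g⁻¹ p.1) ⁻¹' E)

theorem restrictedCoupling_univ [MulAction Γ B] (hR : IsLogRNCocycle ν R) {E : Set ℝ}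
    (hE : MeasurableSet E) (n : ℕ) :
    restrictedCoupling ν R Υ E n Set.univ = zeta ν R Υ n E := by
  have hRm := hR.measurable
  rw [restrictedCoupling, zeta, Measure.sum_apply _ .univ, Measure.sum_apply _ hE]
  refine tsum_congr fun g => ?_
  rw [Measure.restrict_apply_univ, Measure.map_apply (by fun_prop) hE, jointMeasure]

theorem restrictedCoupling_le (E : Set ℝ) (n : ℕ) :
    restrictedCoupling ν R Υ E n ≤ coupling ν Υ n :=
  Measure.le_iff.2 fun S hS => by
    rw [restrictedCoupling, coupling, Measure.sum_apply _ hS, Measure.sum_apply _ hS]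
    exact ENNReal.tsum_le_tsum fun g => Measure.restrict_apply_le _ _

variable [Countable Γ] [MetricSpace B] [MulAction Γ B] [MeasurableSpace X] [MulAction Γ X]
  {μ : Measure X} {A : Set (B × X)}

theorem lintegral_restrictedCoupling_ball_le [SFinite μ] {ρ : Measure ℝ} [SFinite ρ]
    (hν : IsNonsingular Γ ν) (hR : IsLogRNCocycle ν R) (hΥ : IsAdmissibleFamily ν R Υ)
    (hμ : IsMeasurePreserving Γ μ) (hA : MeasurableSet A) {η T : ℝ}
    (hsep : ∀ p ∈ A, ∀ g : Γ, g • p ∈ A → 2 * η ≤ |R g p.1 - T|) {C : ℝ}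
    {K : ℝ≥0} (hK : ∀ s, |s| ≤ C → ρ.map (fun t => t + s) ≤ K • ρ) {n : ℕ}
    (hC : ∀ g, ∀ᵐ p ∂ν.prod ν, 0 < Υ n g p.1 p.2 → |R g⁻¹ p.1| + |R g⁻¹ p.2| ≤ C) :
    ∫⁻ p, μ.prod ρ (Prod.mk p.1 ⁻¹' maharamSaturation R A η)
        ∂restrictedCoupling ν R Υ (Metric.ball T η) n ≤
      K * (∫⁻ p, μ.prod ρ (symmDiff (Prod.mk p.1 ⁻¹' maharamSaturation R A η)
          (Prod.mk p.2 ⁻¹' maharamSaturation R A η)) ∂coupling ν Υ n +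
        ∫⁻ p, μ.prod ρ (symmDiff (Prod.mk p.1 ⁻¹' maharamSaturation R A η)
          (Prod.mk p.2 ⁻¹' maharamSaturation R A η)) ∂translatedCoupling ν Υ n) := by
  have := hν.measurableConstSMul
  have := hμ.isNonsingular.measurableConstSMul
  have := hR.measurable
  set D : B × B → ℝ≥0∞ := fun p => μ.prod ρ (symmDiff
    (Prod.mk p.1 ⁻¹' maharamSaturation R A η) (Prod.mk p.2 ⁻¹' maharamSaturation R A η))
  have hD : Measurable D :=
    measurable_measure_symmDiff_section _ (measurableSet_maharamSaturation hR hA η)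
  simp only [restrictedCoupling, coupling, translatedCoupling, lintegral_sum_measure]
  rw [← ENNReal.tsum_add, ← ENNReal.tsum_mul_left]
  refine ENNReal.tsum_le_tsum fun g => ?_
  rw [lintegral_map hD (measurable_const_smul _), ← lintegral_add_left hD,
    ← lintegral_const_mul _ (by fun_prop)]
  refine le_trans ?_ (setLIntegral_le_lintegral
    ((fun p : B × B => R g⁻¹ p.2 - R g⁻¹ p.1) ⁻¹' Metric.ball T η) _)
  refine setLIntegral_mono_ae (by fun_prop) ?_
  filter_upwards [hΥ.ae_jointMeasure_iff.2 (hC g)] with p hp hT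
  exact measure_section_maharamSaturation_le hR hμ hA hsep hK hp hT

variable [BorelSpace B] [IsFiniteMeasure ν] [IsFiniteMeasure μ] [NeZero μ]

theorem tendsto_zeta_ball (hν : IsNonsingular Γ ν) (hR : IsLogRNCocycle ν R)
    (hΥ : IsAdmissibleFamily ν R Υ) (hμ : IsMeasurePreserving Γ μ) (hA : MeasurableSet A)
    (hsat : ∀ᵐ p ∂ν.prod μ, ∃ g : Γ, g • p ∈ A) {η T : ℝ} (hη : 0 < η)
    (hsep : ∀ p ∈ A, ∀ g : Γ, g • p ∈ A → 2 * η ≤ |R g p.1 - T|) :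
    Tendsto (fun n => zeta ν R Υ n (Metric.ball T η)) atTop (𝓝 0) := by
  have := hν.measurableConstSMul
  have := hμ.isNonsingular.measurableConstSMul
  obtain ⟨C, -, hC⟩ := hΥ.cocycle_bound
  obtain ⟨ρ, _, hρ, htrans⟩ := exists_isFiniteMeasure_map_add_right_le
  obtain ⟨K, hK⟩ := htrans C
  have hW : MeasurableSet (maharamSaturation R A η) := measurableSet_maharamSaturation hR hA η
  have hw : Measurable fun b => μ.prod ρ (Prod.mk b ⁻¹' maharamSaturation R A η) :=
    measurable_measure_prodMk_left hW
  have hdiag := ENNReal.Tendsto.const_mul (a := K)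
    ((hΥ.isAsymptoticallyDiagonal_coupling.tendsto_lintegral_measure_symmDiff_section
      (μ.prod ρ) hW).add ((hΥ.isAsymptoticallyDiagonal_translatedCoupling
        hν).tendsto_lintegral_measure_symmDiff_section (μ.prod ρ) hW)) (Or.inr ENNReal.coe_ne_top)
  simp only [← restrictedCoupling_univ hR Metric.isOpen_ball.measurableSet, ← Measure.fst_univ]
  have hle : ∀ n, (restrictedCoupling ν R Υ (Metric.ball T η) n).fst ≤ ν := fun n =>
    (Measure.fst_mono (restrictedCoupling_le _ n)).trans_eq (hΥ.fst_coupling n)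
  refine tendsto_measure_univ_of_tendsto_lintegral hle hw
    (ae_measure_section_maharamSaturation_pos hR hA hsat hρ hη) ?_
  rw [add_zero, mul_zero] at hdiag
  refine tendsto_of_tendsto_of_tendsto_of_le_of_le tendsto_const_nhds hdiag
    (fun _ => zero_le) fun n => ?_
  dsimp only
  rw [Measure.fst, lintegral_map hw measurable_fst]
  exact lintegral_restrictedCoupling_ball_le hν hR hΥ hμ hA hsep hK (hC n)

end Return

theorem IsErgodic.ae_exists_smul_mem {Γ Ω : Type*} [Group Γ] [Countable Γ] [MulAction Γ Ω]
    [MeasurableSpace Ω] [MeasurableConstSMul Γ Ω] {m : Measure Ω} (hm : IsErgodic Γ m) {A : Set Ω}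
    (hA : MeasurableSet A) (hpos : 0 < m A) : ∀ᵐ p ∂m, ∃ g : Γ, g • p ∈ A := by
  have hmem : ∀ p, p ∈ ⋃ g : Γ, (g • ·) ⁻¹' A ↔ ∃ g : Γ, g • p ∈ A := fun p => by
    simp only [Set.mem_iUnion, Set.mem_preimage]
  have hinv : ∀ h : Γ, (h • ·) ⁻¹' (⋃ g : Γ, (g • ·) ⁻¹' A) = ⋃ g : Γ, (g • ·) ⁻¹' A := fun h => by
    ext p
    rw [Set.mem_preimage, hmem, hmem]
    exact (Equiv.mulRight h).exists_congr fun g => by rw [Equiv.coe_mulRight, mul_smul]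
  have hnull : m (⋃ g : Γ, (g • ·) ⁻¹' A) ≠ 0 := fun h => hpos.ne' <|
    measure_mono_null (fun p hp => Set.mem_iUnion.2 ⟨1, by simpa using hp⟩) h
  filter_upwards [(hm _ (.iUnion fun g => measurable_const_smul g hA) hinv).resolve_left hnull]
    with p hp using (hmem p).1 hp

theorem IsErgodic.map {Γ Ω Ω' : Type*} [Group Γ] [MulAction Γ Ω] [MeasurableSpace Ω]
    [MulAction Γ Ω'] [MeasurableSpace Ω'] {m : Measure Ω} (hm : IsErgodic Γ m) {f : Ω → Ω'}
    (hf : Measurable f) (hequiv : ∀ (g : Γ) p, f (g • p) = g • f p) : IsErgodic Γ (m.map f) := by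
  intro s hs hinv
  rw [Measure.map_apply hf hs, Measure.map_apply hf hs.compl]
  refine hm _ (hf hs) fun g => ?_
  ext p
  rw [Set.mem_preimage, Set.mem_preimage, Set.mem_preimage, hequiv]
  exact Set.ext_iff.1 (hinv g) (f p)

theorem prod_bind {B X Y : Type*} [MeasurableSpace B] [MeasurableSpace X] [MeasurableSpace Y]
    (ν : Measure B) [SFinite ν] (μ : Measure X) [SFinite μ] (κ : Kernel X Y) [IsSFiniteKernel κ] :
    ν.prod (μ.bind κ) = μ.bind (Kernel.const X ν ×ₖ κ) := by
  ext E hE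
  rw [Measure.prod_apply_symm hE, Measure.lintegral_bind κ.measurable.aemeasurable
    (measurable_measure_prodMk_right hE).aemeasurable,
    Measure.bind_apply hE (Kernel.const X ν ×ₖ κ).measurable.aemeasurable]
  exact lintegral_congr fun ω => by
    rw [Kernel.prod_apply, Kernel.const_apply, Measure.prod_apply_symm hE]

/-- `T` is an essential value, in the sense of Schmidt, of the family `r` of functions indexed by
the group elements: every set of positive measure has returns `p ↦ g • p`, on a set of positive
measure, at which `r g p` is close to `T`. -/
def IsEssentialValue {Γ Ω : Type*} [Group Γ] [MeasurableSpace Ω] [MulAction Γ Ω] (m : Measure Ω)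
    (r : Γ → Ω → ℝ) (T : ℝ) : Prop :=
  ∀ A : Set Ω, MeasurableSet A → 0 < m A → ∀ δ : ℝ, 0 < δ →
    ∃ g : Γ, 0 < m {p | p ∈ A ∧ g • p ∈ A ∧ |r g p - T| < δ}

theorem measurableSet_return {Γ Ω : Type*} [Group Γ] [MeasurableSpace Ω] [MulAction Γ Ω]
    [MeasurableConstSMul Γ Ω] {r : Γ → Ω → ℝ} (hr : ∀ g, Measurable (r g)) {A : Set Ω}
    (hA : MeasurableSet A) (T δ : ℝ) (g : Γ) :
    MeasurableSet {p | p ∈ A ∧ g • p ∈ A ∧ |r g p - T| < δ} :=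
  hA.inter ((measurable_const_smul g hA).inter
    (measurableSet_lt ((hr g).sub_const T).abs measurable_const))

namespace IsEssentialValue

variable {Γ Ω : Type*} [Group Γ] [MeasurableSpace Ω] [MulAction Γ Ω] {r : Γ → Ω → ℝ} {T : ℝ}

theorem ofReal_exp_mem_ratioSet {m : Measure Ω} [IsFiniteMeasure m] (h : IsEssentialValue m r T)
    (hm : IsNonsingular Γ m) (hr : IsLogRNCocycle m r) (hT : T ≠ 0) :
    ENNReal.ofReal (Real.exp T) ∈ ratioSet Γ m := by
  have := hm.measurableConstSMul
  refine fun A hA hpos => ⟨fun _ ε hε => ?_, fun htop => absurd htop ENNReal.ofReal_ne_top⟩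
  rw [ENNReal.toReal_ofReal (Real.exp_pos T).le]
  obtain ⟨δ, hδ, hexp⟩ := Metric.continuousAt_iff.1 Real.continuous_exp.continuousAt ε hε
  obtain ⟨g, hg⟩ := h A hA hpos (min δ |T|) (lt_min hδ (abs_pos.2 hT))
  have hrn : MeasurableSet {p | (rnDerivAction m g p).toReal = Real.exp (r g p)} :=
    measurableSet_eq_fun (measurable_rnDerivAction g).ennreal_toReal
      (Real.measurable_exp.comp (hr.measurable g))
  refine ⟨_, Set.inter_subset_left.trans fun p hp => hp.1,
    (measurableSet_return hr.measurable hA T (min δ |T|) g).inter hrn,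
    by rwa [measure_inter_conull (hr.toReal_rnDerivAction hm g)],
    g, ?_, fun p hp => hp.1.2.1, fun p hp => ?_⟩
  · rintro rfl
    obtain ⟨p, -, -, hp⟩ := nonempty_of_measure_ne_zero hg.ne'
    rw [hr.map_one, zero_sub, abs_neg] at hp
    exact (min_le_right _ _).not_gt hp
  · rw [hp.2, ← Real.dist_eq]
    exact hexp (hp.1.2.2.trans_le (min_le_left _ _))

theorem of_prod {X : Type*} [MeasurableSpace X] [MulAction Γ X] {m : Measure Ω} {μ : Measure X}
    [SFinite μ] [NeZero μ]
    (h : IsEssentialValue (m.prod μ) (fun g (p : Ω × X) => r g p.1) T) :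
    IsEssentialValue m r T := by
  intro A hA hpos δ hδ
  have hpos' : 0 < (m.prod μ) (A ×ˢ Set.univ) := by
    rw [Measure.prod_prod]
    exact ENNReal.mul_pos hpos.ne' (NeZero.ne _)
  obtain ⟨g, hg⟩ := h (A ×ˢ Set.univ) (hA.prod .univ) hpos' δ hδ
  have hprod : {p : Ω × X | p ∈ A ×ˢ Set.univ ∧ g • p ∈ A ×ˢ Set.univ ∧ |r g p.1 - T| < δ} =
      {b | b ∈ A ∧ g • b ∈ A ∧ |r g b - T| < δ} ×ˢ Set.univ := by
    ext p
    simp only [Set.mem_ofPred_eq, Set.mem_prod, Set.mem_univ, and_true, Prod.smul_fst]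
  rw [hprod, Measure.prod_prod] at hg
  exact ⟨g, pos_of_mul_pos_left hg zero_le⟩

theorem bind [Countable Γ] [MeasurableConstSMul Γ Ω] {X : Type*} [MeasurableSpace X]
    {P : Measure X} {η : Kernel X Ω} (hr : ∀ g, Measurable (r g))
    (h : ∀ᵐ ω ∂P, IsEssentialValue (η ω) r T) : IsEssentialValue (P.bind η) r T := by
  intro A hA hpos δ hδ
  by_contra! hnull
  have hbind : ∀ {E : Set Ω}, MeasurableSet E → (P.bind η E = 0 ↔ ∀ᵐ ω ∂P, η ω E = 0) :=
    fun {E} hE => by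
      rw [Measure.bind_apply hE η.measurable.aemeasurable,
        lintegral_eq_zero_iff (η.measurable_coe hE)]
      rfl
  have hreturn : ∀ᵐ ω ∂P, ∀ g : Γ, η ω {p | p ∈ A ∧ g • p ∈ A ∧ |r g p - T| < δ} = 0 :=
    ae_all_iff.2 fun g => (hbind (measurableSet_return hr hA T δ g)).1 (le_zero_iff.1 (hnull g))
  refine hpos.ne' ((hbind hA).2 ?_)
  filter_upwards [h, hreturn] with ω hω hωr
  by_contra hne
  obtain ⟨g, hg⟩ := hω A hA (pos_iff_ne_zero.2 hne) δ hδ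
  exact hg.ne' (hωr g)

end IsEssentialValue

section EssentialValue

variable {Γ B X : Type*} [Group Γ] [Countable Γ] [MetricSpace B] [MeasurableSpace B]
  [BorelSpace B] [MulAction Γ B] {ν : Measure B} [IsProbabilityMeasure ν] {R : Γ → B → ℝ}
  {Υ : ℕ → Γ → B → B → ℝ≥0} [MeasurableSpace X] [MulAction Γ X] {μ : Measure X}
  [IsFiniteMeasure μ] [NeZero μ]

theorem exists_return_near (hν : IsNonsingular Γ ν) (hR : IsLogRNCocycle ν R)
    (hΥ : IsAdmissibleFamily ν R Υ) {ζ : ProbabilityMeasure ℝ}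
    (hζ : MapClusterPt ζ atTop (zetaProb hR hΥ)) {T : ℝ} (hTζ : T ∈ (ζ : Measure ℝ).support)
    (hμ : IsMeasurePreserving Γ μ) {A : Set (B × X)} (hA : MeasurableSet A)
    (hsat : ∀ᵐ p ∂ν.prod μ, ∃ g : Γ, g • p ∈ A) {η : ℝ} (hη : 0 < η) :
    ∃ p ∈ A, ∃ g : Γ, g • p ∈ A ∧ |R g p.1 - T| < 2 * η := by
  by_contra! hsep
  have hlim := tendsto_zeta_ball hν hR hΥ hμ hA hsat hη hsep
  obtain ⟨U, hU, hUζ⟩ := mapClusterPt_iff_ultrafilter.1 hζ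
  have hliminf := ProbabilityMeasure.le_liminf_measure_open_of_tendsto hUζ
    (Metric.isOpen_ball (x := T) (ε := η))
  have hzero : Tendsto (fun n => (zetaProb hR hΥ n : Measure ℝ) (Metric.ball T η)) U (𝓝 0) :=
    hlim.mono_left hU
  rw [hzero.liminf_eq] at hliminf
  exact ((Measure.mem_support_iff_forall T).1 hTζ _ (Metric.ball_mem_nhds T hη)).not_ge hliminf

theorem isEssentialValue_of_mem_support (hν : IsNonsingular Γ ν) (hR : IsLogRNCocycle ν R)
    (hΥ : IsAdmissibleFamily ν R Υ) {ζ : ProbabilityMeasure ℝ}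
    (hζ : MapClusterPt ζ atTop (zetaProb hR hΥ)) {T : ℝ} (hTζ : T ∈ (ζ : Measure ℝ).support)
    (hμ : IsMeasurePreserving Γ μ) (herg : IsErgodic Γ (ν.prod μ)) :
    IsEssentialValue (ν.prod μ) (fun g (p : B × X) => R g p.1) T := by
  intro A hA hpos δ hδ
  by_contra! hnull
  have hns := hν.prod hμ.isNonsingular
  have := hns.measurableConstSMul
  set N : Set (B × X) := ⋃ g : Γ, {p | p ∈ A ∧ g • p ∈ A ∧ |R g p.1 - T| < δ}
  have hN : MeasurableSet N := .iUnion fun g =>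
    measurableSet_return (fun g => (hR.measurable g).comp measurable_fst) hA T δ g
  have hN₀ : ν.prod μ N = 0 := measure_iUnion_null fun g => le_zero_iff.1 (hnull g)
  have hsat : ∀ᵐ p ∂ν.prod μ, ∃ g : Γ, g • p ∈ A \ N :=
    herg.ae_exists_smul_mem (hA.diff hN) (by rwa [measure_sdiff_null hN₀])
  obtain ⟨p, hp, g, hg, hT⟩ :=
    exists_return_near hν hR hΥ hζ hTζ hμ (hA.diff hN) hsat (half_pos hδ)
  exact hp.2 (Set.mem_iUnion.2 ⟨g, hp.1, hg.1, hT.trans_eq (mul_div_cancel₀ δ two_ne_zero)⟩)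

theorem isEssentialValue_of_isErgodic (hν : IsNonsingular Γ ν) (hR : IsLogRNCocycle ν R)
    (hΥ : IsAdmissibleFamily ν R Υ) {ζ : ProbabilityMeasure ℝ}
    (hζ : MapClusterPt ζ atTop (zetaProb hR hΥ)) {T : ℝ} (hTζ : T ∈ (ζ : Measure ℝ).support)
    (herg : IsErgodic Γ ν) : IsEssentialValue ν R T := by
  have hunit : IsMeasurePreserving Γ (Measure.dirac ()) := fun _ => MeasurePreserving.id _
  refine (isEssentialValue_of_mem_support hν hR hΥ hζ hTζ hunit ?_).of_prod
  rw [Measure.prod_dirac]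
  exact herg.map (by fun_prop) fun _ _ => rfl

end EssentialValue

theorem exists_mem_forall_eq_of_norm_le {E : Type*} [NormedAddCommGroup E] [InnerProductSpace ℝ E]
    [CompleteSpace E] {K : Set E} (hne : K.Nonempty) (hK : IsClosed K) (hconv : Convex ℝ K) :
    ∃ u ∈ K, ∀ v ∈ K, ‖v‖ ≤ ‖u‖ → v = u := by
  obtain ⟨u, hu, hmin⟩ := exists_norm_eq_iInf_of_complete_convex hne hK.isComplete hconv 0
  refine ⟨u, hu, fun v hv hle => ?_⟩
  have hinner := (norm_eq_iInf_iff_real_inner_le_zero hconv hu).1 hmin v hv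
  rw [zero_sub, inner_neg_left, inner_sub_right, real_inner_self_eq_norm_sq] at hinner
  have hsq : ‖v - u‖ ^ 2 ≤ 0 := by
    rw [norm_sub_sq_real, real_inner_comm]
    linarith [pow_le_pow_left₀ (norm_nonneg v) hle 2]
  exact sub_eq_zero.1 (norm_eq_zero.1 (pow_eq_zero_iff two_ne_zero |>.1
    (hsq.antisymm (sq_nonneg _))))

/-- The convex hull of the translates of a function `f`: the functions that are finite averages of
`f` over the group. -/
def translateHull (Γ : Type*) {X : Type*} [Group Γ] [MulAction Γ X] (f : X → ℝ) : Set (X → ℝ) :=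
  convexHull ℝ (Set.range fun (g : Γ) x => f (g • x))

/-- The `σ`-algebra of invariant measurable sets. -/
@[reducible]
def invariantSets (Γ X : Type*) [Group Γ] [MulAction Γ X] [MeasurableSpace X] :
    MeasurableSpace X :=
  ⨅ g : Γ, MeasurableSpace.invariants fun x : X => g • x

section InvariantSets

variable {Γ X : Type*} [Group Γ] [MulAction Γ X] {f : X → ℝ}

theorem mem_translateHull_self : f ∈ translateHull Γ f :=
  subset_convexHull ℝ _ ⟨1, funext fun x => congrArg f (one_smul Γ x)⟩

theorem comp_smul_mem_translateHull (g : Γ) {φ : X → ℝ} (hφ : φ ∈ translateHull Γ f) :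
    (fun x => φ (g • x)) ∈ translateHull Γ f := by
  have h := Set.mem_image_of_mem (LinearMap.funLeft ℝ ℝ fun x : X => g • x) hφ
  rw [translateHull, LinearMap.image_convexHull] at h
  refine convexHull_mono ?_ h
  rintro _ ⟨_, ⟨h, rfl⟩, rfl⟩
  exact ⟨h * g, funext fun x => congrArg f (mul_smul h g x)⟩

variable [MeasurableSpace X]

theorem measurable_of_mem_translateHull [MeasurableConstSMul Γ X] (hf : Measurable f) {φ : X → ℝ}
    (hφ : φ ∈ translateHull Γ f) : Measurable φ := by
  refine convexHull_min (t := {φ | Measurable φ}) ?_ ?_ hφ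
  · rintro _ ⟨g, rfl⟩
    exact hf.comp (measurable_const_smul g)
  · exact fun φ hφ ψ hψ a b _ _ _ => (hφ.const_smul a).add (hψ.const_smul b)

theorem measurableSet_invariantSets {s : Set X} : MeasurableSet[invariantSets Γ X] s ↔
    MeasurableSet s ∧ ∀ g : Γ, (fun x => g • x) ⁻¹' s = s := by
  rw [invariantSets, MeasurableSpace.measurableSet_iInf]
  simp only [MeasurableSpace.measurableSet_invariants]
  exact ⟨fun h => ⟨(h 1).1, fun g => (h g).2⟩, fun h g => ⟨h.1, h.2 g⟩⟩

theorem invariantSets_le : invariantSets Γ X ≤ ‹MeasurableSpace X› := fun _ hs =>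
  (measurableSet_invariantSets.1 hs).1

variable {μ : Measure X}

theorem integrable_and_setIntegral_eq_of_mem_translateHull (hμ : IsMeasurePreserving Γ μ)
    (hf : Integrable f μ) {S : Set X} (hS : MeasurableSet[invariantSets Γ X] S) {φ : X → ℝ}
    (hφ : φ ∈ translateHull Γ f) : Integrable φ μ ∧ ∫ x in S, φ x ∂μ = ∫ x in S, f x ∂μ := by
  refine convexHull_min (t := {φ | Integrable φ μ ∧ ∫ x in S, φ x ∂μ = ∫ x in S, f x ∂μ}) ?_ ?_ hφ
  · rintro _ ⟨g, rfl⟩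
    obtain ⟨hSm, hSg⟩ := measurableSet_invariantSets.1 hS
    refine ⟨(hμ g).integrable_comp_of_integrable hf, ?_⟩
    conv_rhs => rw [← (hμ g).map_eq]
    rw [setIntegral_map hSm (by rw [(hμ g).map_eq]; exact hf.aestronglyMeasurable)
      (hμ g).aemeasurable, hSg]
  · rintro φ ⟨hφ, hφS⟩ ψ ⟨hψ, hψS⟩ a b - - hab
    refine ⟨(hφ.smul a).add (hψ.smul b), ?_⟩
    rw [integral_add' (hφ.smul a).integrableOn (hψ.smul b).integrableOn]
    simp only [Pi.smul_apply]
    rw [integral_smul, integral_smul, hφS, hψS, ← add_smul, hab, one_smul]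

theorem exists_invariant_representative [Countable Γ] [MeasurableConstSMul Γ X] {p : X → ℝ}
    (hp : Measurable p) (hinv : ∀ g : Γ, ∀ᵐ x ∂μ, p (g • x) = p x) :
    ∃ q : X → ℝ, Measurable[invariantSets Γ X] q ∧ p =ᵐ[μ] q := by
  classical
  set N : Set X := ⋂ g : Γ, {x | p (g • x) = p x}
  have hN : MeasurableSet N :=
    .iInter fun g => measurableSet_eq_fun (hp.comp (measurable_const_smul g)) hp
  have hmem : ∀ x, x ∈ N ↔ ∀ g : Γ, p (g • x) = p x := fun x => Set.mem_iInter
  have hsmul : ∀ (g : Γ), ∀ x ∈ N, g • x ∈ N := fun g x hx => (hmem _).2 fun h => by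
    rw [← mul_smul, (hmem x).1 hx, (hmem x).1 hx]
  have hiff : ∀ (g : Γ) (x : X), g • x ∈ N ↔ x ∈ N := fun g x =>
    ⟨fun h => by simpa using hsmul g⁻¹ _ h, hsmul g x⟩
  refine ⟨N.indicator p, fun t ht => measurableSet_invariantSets.2
    ⟨(hp.indicator hN) ht, fun g => ?_⟩, ?_⟩
  · rw [← Set.preimage_comp]
    congr 1 with x
    by_cases hx : x ∈ N
    · simp only [Function.comp_apply, Set.indicator, hx, hiff, (hmem x).1 hx g]
    · simp only [Function.comp_apply, Set.indicator, hx, hiff, if_false]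
  · filter_upwards [ae_all_iff.2 hinv] with x hx
    rw [Set.indicator_of_mem ((hmem x).2 hx)]

end InvariantSets

section MeanErgodic

variable {Γ X : Type*} [Group Γ] [MulAction Γ X] [MeasurableSpace X] {μ : Measure X} {f : X → ℝ}

theorem exists_invariant_mem_closure_translateHull [MeasurableConstSMul Γ X]
    [SMulInvariantMeasure Γ X μ] (hf : MemLp f 2 μ) :
    ∃ u : Lp ℝ 2 μ, (∀ g : Γ, DomMulAct.mk g • u = u) ∧
      u ∈ closure {v : Lp ℝ 2 μ | ∃ φ ∈ translateHull Γ f, v =ᵐ[μ] φ} := by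
  set K : Set (Lp ℝ 2 μ) := {v | ∃ φ ∈ translateHull Γ f, v =ᵐ[μ] φ}
  have hne : K.Nonempty := ⟨hf.toLp f, f, mem_translateHull_self, hf.coeFn_toLp⟩
  have hconv : Convex ℝ K := by
    rintro u ⟨φ, hφ, hu⟩ v ⟨ψ, hψ, hv⟩ a b ha hb hab
    have hau := (Lp.coeFn_smul a u).trans (hu.const_smul a)
    have hbv := (Lp.coeFn_smul b v).trans (hv.const_smul b)
    exact ⟨_, convex_convexHull ℝ _ hφ hψ ha hb hab, (Lp.coeFn_add _ _).trans (hau.add hbv)⟩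
  have hsmul : ∀ g : Γ, Set.MapsTo (DomMulAct.mk g • ·) K K := by
    rintro g v ⟨φ, hφ, hv⟩
    exact ⟨_, comp_smul_mem_translateHull g hφ, (DomMulAct.smul_Lp_ae_eq _ v).trans
      ((measurePreserving_smul g μ).quasiMeasurePreserving.ae hv)⟩
  obtain ⟨u, hu, huniq⟩ :=
    exists_mem_forall_eq_of_norm_le hne.closure isClosed_closure hconv.closure
  exact ⟨u, fun g => huniq _ ((hsmul g).closure (continuous_const_smul _) hu)
    (DomMulAct.norm_smul_Lp _ u).le, hu⟩

/-- A form of the mean ergodic theorem that needs no averaging sequence in the group. -/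
theorem exists_tendsto_translateHull [Countable Γ] [IsProbabilityMeasure μ]
    (hμ : IsMeasurePreserving Γ μ) (hf : MemLp f 2 μ) :
    ∃ p : X → ℝ, Measurable[invariantSets Γ X] p ∧ ∃ φ : ℕ → X → ℝ,
      (∀ k, φ k ∈ translateHull Γ f) ∧
      Tendsto (fun k => ∫⁻ x, ‖φ k x - p x‖ₑ ∂μ) atTop (𝓝 0) := by
  have := hμ.isNonsingular.measurableConstSMul
  have : SMulInvariantMeasure Γ X μ := ⟨fun g t ht => (hμ g).measure_preimage ht.nullMeasurableSet⟩
  obtain ⟨u, hinv, hu⟩ := exists_invariant_mem_closure_translateHull (Γ := Γ) hf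
  obtain ⟨v, hv, hlim⟩ := mem_closure_iff_seq_limit.1 hu
  choose φ hφ hvφ using hv
  obtain ⟨p, hp, hup⟩ := exists_invariant_representative (Lp.stronglyMeasurable u).measurable
    fun g : Γ => by
      have hg := DomMulAct.smul_Lp_ae_eq (DomMulAct.mk g) u
      rw [hinv g] at hg
      exact hg.symm
  refine ⟨p, hp, φ, hφ, ?_⟩
  refine tendsto_of_tendsto_of_tendsto_of_le_of_le tendsto_const_nhds
    (tendsto_iff_edist_tendsto_0.1 hlim) (fun _ => zero_le) fun k => ?_
  calc ∫⁻ x, ‖φ k x - p x‖ₑ ∂μ = eLpNorm (v k - u : Lp ℝ 2 μ) 1 μ := by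
        rw [eLpNorm_one_eq_lintegral_enorm]
        refine lintegral_congr_ae ?_
        filter_upwards [hvφ k, hup, Lp.coeFn_sub (v k) u] with x hvx hux hsub
        rw [hsub, Pi.sub_apply, hvx, hux]
    _ ≤ eLpNorm (v k - u : Lp ℝ 2 μ) 2 μ :=
        eLpNorm_le_eLpNorm_of_exponent_le one_le_two (Lp.aestronglyMeasurable _)
    _ = edist (v k) u := by rw [edist_eq_enorm_sub, Lp.enorm_def]

end MeanErgodic

section ErgodicityCriterion

variable {Γ X : Type*} [Group Γ] [MulAction Γ X] [MeasurableSpace X] {μ : Measure X}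

theorem setIntegral_eq_of_iInf_translateHull_eq_zero [IsFiniteMeasure μ]
    (hμ : IsMeasurePreserving Γ μ) {f : X → ℝ} (hf : Integrable f μ) {c : ℝ}
    (hc : ⨅ φ ∈ translateHull Γ f, ∫⁻ x, ‖φ x - c‖ₑ ∂μ = 0) {S : Set X}
    (hS : MeasurableSet[invariantSets Γ X] S) : ∫ x in S, f x ∂μ = c * μ.real S := by
  have hle : ‖∫ x in S, f x ∂μ - c * μ.real S‖ₑ ≤ ⨅ φ ∈ translateHull Γ f, ∫⁻ x, ‖φ x - c‖ₑ ∂μ := by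
    refine le_iInf₂ fun φ hφ => ?_
    obtain ⟨hφi, hφS⟩ := integrable_and_setIntegral_eq_of_mem_translateHull hμ hf hS hφ
    have hsub : ∫ x in S, (φ x - c) ∂μ = ∫ x in S, f x ∂μ - c * μ.real S := by
      rw [integral_sub hφi.integrableOn (integrable_const c), hφS, setIntegral_const, smul_eq_mul,
        mul_comm]
    rw [← hsub]
    exact (enorm_integral_le_lintegral_enorm _).trans (setLIntegral_le_lintegral _ _)
  rwa [hc, nonpos_iff_eq_zero, enorm_eq_zero, sub_eq_zero] at hle

theorem measure_inter_eq_mul_of_iInf_translateHull_eq_zero [IsProbabilityMeasure μ]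
    (hμ : IsMeasurePreserving Γ μ) {s : Set X} (hs : MeasurableSet s) {c : ℝ}
    (hc : ⨅ φ ∈ translateHull Γ (s.indicator 1), ∫⁻ x, ‖φ x - c‖ₑ ∂μ = 0) {S : Set X}
    (hS : MeasurableSet[invariantSets Γ X] S) : μ (S ∩ s) = μ S * μ s := by
  have hreal : ∀ {S}, MeasurableSet[invariantSets Γ X] S → μ.real (s ∩ S) = c * μ.real S :=
    fun {S} hS => by
      rw [← setIntegral_eq_of_iInf_translateHull_eq_zero hμ
        ((integrable_const 1).indicator hs) hc hS, integral_indicator_one hs,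
        measureReal_restrict_apply hs]
  have hcs : μ.real s = c := by
    simpa using hreal (S := Set.univ) MeasurableSet.univ
  rw [Set.inter_comm, mul_comm, ← ENNReal.toReal_eq_toReal_iff' (by finiteness) (by finiteness),
    ENNReal.toReal_mul]
  exact (hreal hS).trans (by rw [← hcs]; rfl)

theorem isErgodic_of_generateFrom [IsProbabilityMeasure μ] {𝒞 : Set (Set X)}
    (hgen : MeasurableSpace.generateFrom 𝒞 = ‹MeasurableSpace X›) (hpi : IsPiSystem 𝒞)
    (hindep : ∀ s ∈ 𝒞, ∀ S, MeasurableSet[invariantSets Γ X] S → μ (S ∩ s) = μ S * μ s) :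
    IsErgodic Γ μ := by
  intro S hS hinv
  have hsets : IndepSets {S} 𝒞 μ := (IndepSets_iff _ _ _).2 fun S' s hS' hs => by
    rw [Set.mem_singleton_iff.1 hS']
    exact hindep s hs S (measurableSet_invariantSets.2 ⟨hS, hinv⟩)
  have hself : IndepSet S S μ := by
    refine (hsets.indep' (fun S' hS' => (Set.mem_singleton_iff.1 hS') ▸ hS)
      (fun s hs => hgen ▸ MeasurableSpace.measurableSet_generateFrom hs) (.singleton S)
      hpi).indepSet_of_measurableSet
      (MeasurableSpace.measurableSet_generateFrom rfl) (by rwa [hgen])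
  exact (measure_eq_zero_or_one_of_indepSet_self hself).imp_right (prob_compl_eq_zero_iff hS).2

theorem exists_countable_isPiSystem_generateFrom_eq (X : Type*) [m : MeasurableSpace X]
    [MeasurableSpace.CountablyGenerated X] :
    ∃ 𝒞 : Set (Set X), 𝒞.Countable ∧ IsPiSystem 𝒞 ∧ MeasurableSpace.generateFrom 𝒞 = m :=
  ⟨generateSetAlgebra (MeasurableSpace.countableGeneratingSet X),
    countable_generateSetAlgebra MeasurableSpace.countable_countableGeneratingSet,
    fun _ hs _ ht _ => isSetAlgebra_generateSetAlgebra.inter_mem hs ht, by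
      rw [generateFrom_generateSetAlgebra_eq, MeasurableSpace.generateFrom_countableGeneratingSet]⟩

end ErgodicityCriterion

section ErgodicDecomposition

variable {X : Type*} {m : MeasurableSpace X} [mX : MeasurableSpace X] [StandardBorelSpace X]
  {μ : Measure X}

theorem bind_comap_condExpKernel [IsFiniteMeasure μ] (hm : m ≤ mX) :
    μ.bind ((condExpKernel μ m).comap id (measurable_id'' hm)) = μ := by
  ext s hs
  rw [Measure.bind_apply hs (Kernel.measurable _).aemeasurable]
  conv_rhs => rw [← condExpKernel_comp_trim (μ := μ) hm,
    Measure.bind_apply hs (Kernel.measurable _).aemeasurable]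
  exact (lintegral_trim hm (measurable_condExpKernel hs)).symm

theorem ae_condExpKernel_ae_eq [IsFiniteMeasure μ] (hm : m ≤ mX) {E : Type*}
    [MeasurableSpace E] [MeasurableEq E] {p : X → E} (hp : Measurable[m] p) :
    ∀ᵐ ω ∂μ, ∀ᵐ x ∂condExpKernel μ m ω, p x = p ω := by
  have hdiag : @Measurable X (X × X) mX (m.prod mX) Function.diag :=
    (measurable_id'' hm).prodMk measurable_id
  have hset : @MeasurableSet (X × X) (m.prod mX) {q | p q.2 = p q.1} :=
    measurableSet_eq_fun (m := m.prod mX)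
      ((hp.mono hm le_rfl).comp (@measurable_snd X X m _)) (hp.comp (@measurable_fst X X m _))
  refine ae_of_ae_trim hm (Measure.ae_ae_of_ae_compProd (p := fun q : X × X => p q.2 = p q.1) ?_)
  rw [compProd_trim_condExpKernel hm]
  exact (ae_map_iff (@Measurable.aemeasurable _ _ mX (m.prod mX) _ _ hdiag) hset).2
    (Eventually.of_forall fun _ => rfl)

variable {Γ : Type*} [Group Γ] [MulAction Γ X] [IsProbabilityMeasure μ]

theorem condExpKernel_invariantSets_preimage_smul (hμ : IsMeasurePreserving Γ μ) (g : Γ) {s : Set X}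
    (hs : MeasurableSet s) :
    ∀ᵐ ω ∂μ, condExpKernel μ (invariantSets Γ X) ω ((fun x => g • x) ⁻¹' s) =
      condExpKernel μ (invariantSets Γ X) ω s := by
  have hle := invariantSets_le (Γ := Γ) (X := X)
  have hgs := (hμ g).measurable hs
  have hcond : μ⟦s | invariantSets Γ X⟧ =ᵐ[μ] μ⟦(fun x => g • x) ⁻¹' s | invariantSets Γ X⟧ := by
    refine ae_eq_condExp_of_forall_setIntegral_eq hle ((integrable_const 1).indicator hgs)
      (fun S _ _ => integrable_condExp.integrableOn) (fun S hS _ => ?_)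
      stronglyMeasurable_condExp.aestronglyMeasurable
    obtain ⟨hSm, hSg⟩ := measurableSet_invariantSets.1 hS
    rw [setIntegral_condExp hle ((integrable_const 1).indicator hs) hS, setIntegral_indicator hs,
      setIntegral_indicator hgs, setIntegral_const, setIntegral_const]
    congr 1
    rw [← (hμ g).measureReal_preimage (hSm.inter hs).nullMeasurableSet, Set.preimage_inter, hSg]
  filter_upwards [hcond, condExpKernel_ae_eq_condExp hle hs (μ := μ),
    condExpKernel_ae_eq_condExp hle hgs (μ := μ)] with ω hω hωs hωgs
  rw [← measureReal_eq_measureReal_iff, hωs, hωgs, hω]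

variable [Countable Γ]

theorem ae_isMeasurePreserving_condExpKernel (hμ : IsMeasurePreserving Γ μ) :
    ∀ᵐ ω ∂μ, IsMeasurePreserving Γ (condExpKernel μ (invariantSets Γ X) ω) := by
  obtain ⟨𝒞, hcount, hpi, hgen⟩ := exists_countable_isPiSystem_generateFrom_eq X
  have hmeas : ∀ s ∈ 𝒞, MeasurableSet s := fun s hs =>
    hgen ▸ MeasurableSpace.measurableSet_generateFrom hs
  have hinv : ∀ᵐ ω ∂μ, ∀ g : Γ, ∀ s ∈ 𝒞, condExpKernel μ (invariantSets Γ X) ω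
      ((fun x => g • x) ⁻¹' s) = condExpKernel μ (invariantSets Γ X) ω s :=
    ae_all_iff.2 fun g => (ae_ball_iff hcount).2 fun s hs =>
      condExpKernel_invariantSets_preimage_smul hμ g (hmeas s hs)
  filter_upwards [hinv] with ω hω g
  have hg := (hμ g).measurable
  have := Measure.isProbabilityMeasure_map (μ := condExpKernel μ (invariantSets Γ X) ω)
    hg.aemeasurable
  refine ⟨hg, ext_of_generate_finite 𝒞 hgen.symm hpi (fun s hs => ?_) (by simp)⟩
  rw [Measure.map_apply hg (hmeas s hs), hω g s hs]

theorem exists_ae_iInf_translateHull_eq_zero (hμ : IsMeasurePreserving Γ μ) {f : X → ℝ}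
    (hf : Measurable f) (hf₂ : MemLp f 2 μ) :
    ∃ p : X → ℝ, ∀ᵐ ω ∂μ, ⨅ φ ∈ translateHull Γ f,
      ∫⁻ x, ‖φ x - p ω‖ₑ ∂condExpKernel μ (invariantSets Γ X) ω = 0 := by
  have := hμ.isNonsingular.measurableConstSMul
  have hle := invariantSets_le (Γ := Γ) (X := X)
  obtain ⟨p, hp, φ, hφ, hlim⟩ := exists_tendsto_translateHull hμ hf₂
  set κ := (condExpKernel μ (invariantSets Γ X)).comap id (measurable_id'' hle)
  have hdist : ∀ k, Measurable fun x => ‖φ k x - p x‖ₑ := fun k =>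
    ((measurable_of_mem_translateHull hf (hφ k)).sub (hp.mono hle le_rfl)).enorm
  have hbind : ∀ k, ∫⁻ ω, ∫⁻ x, ‖φ k x - p x‖ₑ ∂κ ω ∂μ = ∫⁻ x, ‖φ k x - p x‖ₑ ∂μ := fun k => by
    rw [← Measure.lintegral_bind κ.measurable.aemeasurable (hdist k).aemeasurable,
      bind_comap_condExpKernel hle]
  have hzero : ∫⁻ ω, ⨅ k, ∫⁻ x, ‖φ k x - p x‖ₑ ∂κ ω ∂μ = 0 :=
    le_zero_iff.1 <| ge_of_tendsto' hlim fun k =>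
      (lintegral_mono fun ω => iInf_le _ k).trans_eq (hbind k)
  rw [lintegral_eq_zero_iff (.iInf fun k => (hdist k).lintegral_kernel)] at hzero
  refine ⟨p, ?_⟩
  filter_upwards [hzero, ae_condExpKernel_ae_eq hle hp] with ω hω hpω
  refine le_zero_iff.1 (le_of_le_of_eq (le_iInf fun k => ?_) hω)
  refine (iInf₂_le (φ k) (hφ k)).trans_eq (lintegral_congr_ae ?_)
  filter_upwards [hpω] with x hx
  rw [hx]

theorem ae_isErgodic_condExpKernel (hμ : IsMeasurePreserving Γ μ) :
    ∀ᵐ ω ∂μ, IsErgodic Γ (condExpKernel μ (invariantSets Γ X) ω) := by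
  obtain ⟨𝒞, hcount, hpi, hgen⟩ := exists_countable_isPiSystem_generateFrom_eq X
  have hmeas : ∀ s ∈ 𝒞, MeasurableSet s := fun s hs =>
    hgen ▸ MeasurableSpace.measurableSet_generateFrom hs
  have happrox : ∀ᵐ ω ∂μ, ∀ s ∈ 𝒞, ∃ c : ℝ, ⨅ φ ∈ translateHull Γ (s.indicator 1),
      ∫⁻ x, ‖φ x - c‖ₑ ∂condExpKernel μ (invariantSets Γ X) ω = 0 := by
    refine (ae_ball_iff hcount).2 fun s hs => ?_
    obtain ⟨p, hp⟩ := exists_ae_iInf_translateHull_eq_zero hμ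
      (measurable_one.indicator (hmeas s hs)) ((memLp_const 1).indicator (hmeas s hs))
    exact hp.mono fun ω hω => ⟨p ω, hω⟩
  filter_upwards [happrox, ae_isMeasurePreserving_condExpKernel hμ] with ω hω hωμ
  refine isErgodic_of_generateFrom hgen hpi fun s hs S hS => ?_
  obtain ⟨c, hc⟩ := hω s hs
  exact measure_inter_eq_mul_of_iInf_translateHull_eq_zero hωμ (hmeas s hs) hc hS

theorem exists_ergodic_decomposition (hμ : IsMeasurePreserving Γ μ) :
    ∃ κ : Kernel X X, IsMarkovKernel κ ∧ μ.bind κ = μ ∧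
      ∀ᵐ ω ∂μ, IsMeasurePreserving Γ (κ ω) ∧ IsErgodic Γ (κ ω) :=
  ⟨_, inferInstance, bind_comap_condExpKernel (invariantSets_le (Γ := Γ)),
    (ae_isMeasurePreserving_condExpKernel hμ).and (ae_isErgodic_condExpKernel hμ)⟩

end ErgodicDecomposition

theorem isEssentialValue_of_isWeaklyMixing {Γ B : Type*} [Group Γ] [Countable Γ] [MetricSpace B]
    [MeasurableSpace B] [BorelSpace B] [MulAction Γ B] {ν : Measure B} [IsProbabilityMeasure ν]
    {R : Γ → B → ℝ} {Υ : ℕ → Γ → B → B → ℝ≥0} (hν : IsNonsingular Γ ν) (hR : IsLogRNCocycle ν R)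
    (hΥ : IsAdmissibleFamily ν R Υ) {ζ : ProbabilityMeasure ℝ}
    (hζ : MapClusterPt ζ atTop (zetaProb hR hΥ)) {T : ℝ} (hTζ : T ∈ (ζ : Measure ℝ).support)
    (hmix : IsWeaklyMixing Γ ν) {X : Type} [MeasurableSpace X] [StandardBorelSpace X]
    [MulAction Γ X] {μ : Measure X} [IsProbabilityMeasure μ] (hμ : IsMeasurePreserving Γ μ) :
    IsEssentialValue (ν.prod μ) (fun g (p : B × X) => R g p.1) T := by
  obtain ⟨κ, hκ, hbind, herg⟩ := exists_ergodic_decomposition hμ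
  have := (hν.prod hμ.isNonsingular).measurableConstSMul
  rw [← hbind, prod_bind]
  refine .bind (fun g => (hR.measurable g).comp measurable_fst) ?_
  filter_upwards [herg] with ω ⟨hωμ, hω⟩
  rw [Kernel.prod_apply, Kernel.const_apply]
  exact isEssentialValue_of_mem_support hν hR hΥ hζ hTζ hωμ (hmix X (κ ω) hωμ hω)

theorem ofReal_exp_notMem {T : ℝ} (hT : T ≠ 0) :
    ENNReal.ofReal (Real.exp T) ∉ ({0, 1, ∞} : Set ℝ≥0∞) := by
  simp [Real.exp_pos, hT, ENNReal.ofReal_eq_one]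

end NonsingularAction

end

theorem corollary3p3_general {Γ : Type*} [Group Γ] [Countable Γ]
    {B : Type*} [MetricSpace B] [MeasurableSpace B] [BorelSpace B]
    [MulAction Γ B] (ν : Measure B) [IsProbabilityMeasure ν]
    (hν : NonsingularAction.IsNonsingular Γ ν)
    (R : Γ → B → ℝ) (hR : NonsingularAction.IsLogRNCocycle ν R)
    (Υ : ℕ → Γ → B → B → ℝ≥0) (hΥ : NonsingularAction.IsAdmissibleFamily ν R Υ)
    (ζ : ProbabilityMeasure ℝ)
    (hζ : MapClusterPt ζ atTop (NonsingularAction.zetaProb hR hΥ))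
    (T : ℝ) (hT : T ≠ 0) (hTζ : T ∈ (ζ : Measure ℝ).support) :
    (NonsingularAction.IsErgodic Γ ν →
      ENNReal.ofReal (Real.exp T) ∈ NonsingularAction.ratioSet Γ ν) ∧
    (NonsingularAction.IsWeaklyMixing Γ ν →
      ENNReal.ofReal (Real.exp T) ∈ NonsingularAction.stableRatioSet Γ ν) := by
  constructor
  · intro herg
    exact (NonsingularAction.isEssentialValue_of_isErgodic hν hR hΥ hζ hTζ herg
      ).ofReal_exp_mem_ratioSet hν hR hT
  · intro hmix X _ _ _ μ _ hμ
    exact (NonsingularAction.isEssentialValue_of_isWeaklyMixing hν hR hΥ hζ hTζ hmix hμ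
      ).ofReal_exp_mem_ratioSet (hν.prod hμ.isNonsingular) (hR.prod hν hμ) hT

theorem corollary3p3 {Γ : Type*} [Group Γ] [Countable Γ]
    {B : Type*} [MetricSpace B] [CompactSpace B] [MeasurableSpace B] [BorelSpace B]
    [MulAction Γ B] (ν : Measure B) [IsProbabilityMeasure ν]
    (hν : NonsingularAction.IsNonsingular Γ ν)
    (R : Γ → B → ℝ) (hR : NonsingularAction.IsLogRNCocycle ν R)
    (Υ : ℕ → Γ → B → B → ℝ≥0) (hΥ : NonsingularAction.IsAdmissibleFamily ν R Υ)
    (ζ : ProbabilityMeasure ℝ)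
    (hζ : MapClusterPt ζ atTop (NonsingularAction.zetaProb hR hΥ))
    (T : ℝ) (hT : T ≠ 0) (hTζ : T ∈ (ζ : Measure ℝ).support) :
    (NonsingularAction.IsErgodic Γ ν → ¬ NonsingularAction.IsTypeIIIZero Γ ν) ∧
    (NonsingularAction.IsWeaklyMixing Γ ν → ¬ NonsingularAction.IsStableTypeIIIZero Γ ν) := by
  obtain ⟨hratio, hstable⟩ := corollary3p3_general ν hν R hR Υ hΥ ζ hζ T hT hTζ
  have hexp := NonsingularAction.ofReal_exp_notMem hT
  exact ⟨fun herg h => hexp (h.2 ▸ hratio herg), fun hmix h => hexp (h.2 ▸ hstable hmix)⟩
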